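/- **Model.** Let $\mathcal A$ be a finite-dimensional Hopf algebra over $\mathbb C$ with $S^2=1$, $n=\dim\mathcal A$, unit $\eta$, co-unit $\epsilon$, a basis $(\phi_i)$ and dual basis $(\phi^i)$ of $\mathcal A^*$, which is an algebra by $(fg)(x)=\sum f(x_{1})g(x_{2})$. Let $\mathrm{tr}$ and $\mathrm{cotr}$ be the traces of the regular representations of $\mathcal A$ and $\mathcal A^*$. Let a closed oriented surface $\Sigma$ carry a finite lattice (cellular decomposition, e.g. a square lattice) with oriented links and $n_l$ links, $n_p$ plaquettes $p$, $n_s$ vertices $s$, each vertex lying on some link. On $\Sigma\times[0,1]$, give each spacelike (timelike) face the tensor $\mathrm{tr}(z\,\phi_{l_1}\cdots\phi_{l_k})$ with central $z=z_S$ ($z=z_T$), the indices being those of its boundary links in cyclic order, and give each spacelike (timelike) link the tensor $\mathrm{cotr}(z^*\phi^{f_1}\cdots\phi^{f_k})$ with co-central $z^*=z_S^*$ ($z^*=z_T^*$), the indices being those of the adjacent faces in cyclic order. The transfer matrix $U=U(z_T,z_S,z_T^*,z_S^*)$, an operator on $\mathcal A^{\otimes n_l}$, is the contraction of these tensors over all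 incidences of a face and a link in one time step, through $S$ when the orientations of face and link disagree; each link of $\Sigma$ has one free incoming index (its bottom copy, on the timelike face above it) and one free outgoing index (its top copy, towards the next timelike face). The plaquette operator $B_p(z)$ contracts $\mathrm{tr}(z\,\phi_{l_1}\cdots\phi_{l_k})$ with a co-multiplication on each boundary link of $p$, run counter-clockwise: a link $x$ run along its orientation is sent to $\sum x_{1}$ and $x_{2}$ enters the trace; a link run backwards is sent to $\sum x_{2}$ and $S(x_{1})$ enters the trace. The star operator $A_s(z^*)$ contracts $\mathrm{cotr}(z^*\phi^{f_1}\cdots\phi^{f_k})$ with a multiplication on each link at $s$, run clockwise: $x\mapsto S(h)x$ for a link leaving $s$, $x\mapsto xh$ for a link entering $s$. Put $B_p^0=B_p(\eta)$, $A_s^0=A_s(\epsilon)$. **Statement.** Let $\lambda\in\mathcal A$ be a co-integral ($x\lambda=\epsilon(x)\lambda$) with $\mathrm{tr}(\lambda)=n$, and $\Lambda\in\mathcal A^*$ an integral ($\Lambda f=f(1)\Lambda$) with $\mathrm{cotr}(\Lambda)=n$. 1. For all central $z_S\in\mathcal A$ and co-central $z_T^*\in\mathcal A^*$, all the operators $B_p(z_S)$,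 $A_s(z_T^*)$ commute with each other and $$U(\eta,z_S,z_T^*,\epsilon)=n^{n_l}\prod_p B_p(z_S)\prod_s A_s(z_T^*).$$ In particular this holds for the elements, which are central and co-central for all real $\delta_p,\delta_s$, $$z_S=\tfrac1n\left[2(1-\delta_p)\eta+\delta_p\lambda\right],\qquad z_T^*=\tfrac1n\left[2(1-\delta_s)\epsilon+\delta_s\Lambda\right].$$ 2. For this choice of $z_S,z_T^*$ with $0<\delta_p,\delta_s\le1$, one has $U=e^{-H}$, and $-H$ is the principal logarithm of $U$ (its spectrum lies in $|\mathrm{Im}\,\mu|<\pi$), where $$H=-\gamma_p\sum_p\left(\mathbf 1-\tfrac2n B_p^0\right)-\gamma_s\sum_s\left(\mathbf 1-\tfrac2n A_s^0\right)-\gamma\,\mathbf 1,$$ $$\gamma_p=\tfrac12\ln\frac{\delta_p}{2-\delta_p}\le0,\quad \gamma_s=\tfrac12\ln\frac{\delta_s}{2-\delta_s}\le0,\quad \gamma=n_l\ln n+\tfrac{n_p}2\ln(\delta_p(2-\delta_p))+\tfrac{n_s}2\ln(\delta_s(2-\delta_s)).$$ 3. This $H$ is the quantum double Hamiltonian up to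 a constant: if $h\in\mathcal A$ and $\varphi\in\mathcal A^*$ are the Haar integrals ($xh=\epsilon(x)h$, $\epsilon(h)=1$; $\varphi f=f(1)\varphi$, $\varphi(1)=1$), and $A_s(h)$, $B_p(\varphi)$ denote the operators obtained from $A_s$, $B_p$ by replacing the tensors $\mathrm{cotr}(z^*\phi^{f_1}\cdots\phi^{f_k})$ and $\mathrm{tr}(z\,\phi_{l_1}\cdots\phi_{l_k})$ by $(\phi^{f_1}\cdots\phi^{f_k})(h)$ and $\varphi(\phi_{l_1}\cdots\phi_{l_k})$, then $$H=-(-2\gamma_s)\sum_s A_s(h)-(-2\gamma_p)\sum_p B_p(\varphi)-(\gamma_p n_p+\gamma_s n_s+\gamma)\mathbf 1 .$$ -/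

import Mathlib

open scoped BigOperators

noncomputable section

namespace HopfLattice

/-! ### Hopf-algebraic data -/

/-- The dual algebra `A*` of a Hopf algebra `A`: linear functionals with the convolution product
`(f * g)(x) = ∑ f(x₁) g(x₂)`; its unit is the co-unit of `A`. -/
abbrev DualAlg (A : Type*) [Ring A] [HopfAlgebra ℂ A] : Type _ := WithConv (A →ₗ[ℂ] ℂ)

/-- The antipode squares to the identity. -/
def IsInvolutory (A : Type*) [Ring A] [HopfAlgebra ℂ A] : Prop :=
  ∀ x : A, HopfAlgebra.antipode ℂ (HopfAlgebra.antipode ℂ x) = x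

/-- The trace of an algebra in its (left) regular representation, `x ↦ Tr (y ↦ x y)`. -/
def regTrace (R : Type*) [Ring R] [Algebra ℂ R] : R →ₗ[ℂ] ℂ :=
  LinearMap.trace ℂ R ∘ₗ LinearMap.mul ℂ R

/-- The regular trace `tr` of the Hopf algebra. -/
def tr (A : Type*) [Ring A] [HopfAlgebra ℂ A] : A →ₗ[ℂ] ℂ := regTrace A

/-- The co-trace `cotr`: the regular trace of the dual algebra. -/
def cotr (A : Type*) [Ring A] [HopfAlgebra ℂ A] : DualAlg A →ₗ[ℂ] ℂ := regTrace (DualAlg A)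

/-- `l ∈ A` is a (left) co-integral: `x l = ε(x) l` for all `x`. -/
def IsCointegral {A : Type*} [Ring A] [HopfAlgebra ℂ A] (l : A) : Prop :=
  ∀ x : A, x * l = Coalgebra.counit (R := ℂ) x • l

/-- `L ∈ A*` is a (right) integral: `L f = f(1) L` for all `f`. -/
def IsIntegralFunctional {A : Type*} [Ring A] [HopfAlgebra ℂ A] (L : DualAlg A) : Prop :=
  ∀ f : DualAlg A, L * f = f 1 • L

/-- The central element `(1/n) (2 (1 - δ) η + δ λ)`, where `n = dim A`. -/
def mixUnit {A : Type*} [Ring A] [HopfAlgebra ℂ A] (δ : ℝ) (l : A) : A :=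
  ((Module.finrank ℂ A : ℂ)⁻¹) • ((2 * (1 - (δ : ℂ))) • (1 : A) + (δ : ℂ) • l)

/-- The co-central element `(1/n) (2 (1 - δ) ε + δ Λ)`, where `n = dim A`. -/
def mixCounit {A : Type*} [Ring A] [HopfAlgebra ℂ A] (δ : ℝ) (L : DualAlg A) : DualAlg A :=
  ((Module.finrank ℂ A : ℂ)⁻¹) • ((2 * (1 - (δ : ℂ))) • (1 : DualAlg A) + (δ : ℂ) • L)

/-! ### Lattices on closed oriented surfaces -/

/-- A dart (oriented half-edge) of a lattice with set of links `E`, every link carrying a reference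
orientation: `(e, true)` is `e` run along its orientation, `(e, false)` is `e` run backwards.
A dart is attached to the vertex at which it starts. -/
abbrev Dart (E : Type*) := E × Bool

/-- The dart on the same link running in the opposite direction. -/
def flipDart (E : Type*) : Equiv.Perm (Dart E) where
  toFun d := (d.1, !d.2)
  invFun d := (d.1, !d.2)
  left_inv d := by simp
  right_inv d := by simp

/-- A lattice (cellular decomposition) of a closed oriented surface `Σ` with set of links `E`,
given by its rotation system: `rot d` is the next dart, counter-clockwise, among the darts that
start at the same vertex as `d`.  A square lattice is the case in which all the cycles of
`face` (and of `rot`) have length four. -/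
structure SurfaceLattice (E : Type*) where
  rot : Equiv.Perm (Dart E)

/-- The cycle of `d` under a permutation of a finite set, as the list
`d, π d, π² d, …` (without repetition). -/
def orbitList {D : Type*} (π : Equiv.Perm D) (d : D) : List D :=
  (List.range (Function.minimalPeriod π d)).map fun k => (π ^ k) d

/-- The set of cycles (orbits) of a permutation. -/
abbrev Cycles {D : Type*} (π : Equiv.Perm D) : Type _ :=
  Quotient (Equiv.Perm.SameCycle.setoid π)

instance {D : Type*} [Finite D] (π : Equiv.Perm D) : Fintype (Cycles π) :=
  Fintype.ofFinite _

/-- The members of a cycle in cyclic order, started at some member. -/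
def cycleList {D : Type*} (π : Equiv.Perm D) (q : Cycles π) : List D :=
  orbitList π (Quotient.out q)

namespace SurfaceLattice

variable {E : Type*}

/-- The successor of a dart on the boundary of the plaquette to its left, which is run
counter-clockwise. -/
def face (L : SurfaceLattice E) : Equiv.Perm (Dart E) := L.rot⁻¹ * flipDart E

/-- The plaquettes of the lattice. -/
abbrev Plaquette (L : SurfaceLattice E) : Type _ := Cycles L.face

/-- The vertices of the lattice.  Going round a vertex clockwise, as a red curve does, is
iterating `rot⁻¹`. -/
abbrev Vertex (L : SurfaceLattice E) : Type _ := Cycles L.rot⁻¹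

end SurfaceLattice

section Model

variable {A : Type*} [Ring A] [HopfAlgebra ℂ A]

/-! ### The transfer matrix as a tensor network -/

/-- Weight of a blue curve coloured by `z`, `tr (z x₁ ⋯ x_k)`; on basis elements this is the tensor
`M_{l₁ … l_k}`. -/
def blueWeight (z : A) (xs : List A) : ℂ := tr A (z * xs.prod)

/-- Weight of a red curve coloured by `z*`, `cotr (z* f₁ ⋯ f_k)`; on dual basis elements this is
the tensor `Δ^{f₁ … f_k}`. -/
def redWeight (zs : DualAlg A) (fs : List (DualAlg A)) : ℂ := cotr A (zs * fs.prod)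

/-- What a blue curve receives at a crossing: the contraction is direct if the blue curve runs along
the orientation of the link and goes through the antipode otherwise. -/
def crossing (direct : Bool) (x : A) : A := if direct then x else HopfAlgebra.antipode ℂ x

variable {ι : Type*} [Fintype ι]

/-- The dual basis. -/
def dualVec (b : Module.Basis ι ℂ A) (i : ι) : DualAlg A := WithConv.toConv (b.coord i)

variable {E : Type*} [Fintype E] [DecidableEq E]

/-- The one-step transfer matrix of the model on `Σ × [0,1]`, as a tensor with one index in and one
index out for each link of `Σ`.  It is the contraction of the weights of all the curves of one
time step:

* a blue curve coloured by `zS` for each plaquette of `Σ`, crossing its boundary links;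
* a blue curve coloured by `zT` for each timelike face `e × [0,1]`; going round its boundary, it
  crosses the link `e` at the bottom (the incoming index), the timelike link at the end of `e`, the
  link `e` at the top (backwards) and the timelike link at the origin of `e` (backwards);
* a red curve coloured by `zTs` for each timelike link `v × [0,1]`, crossing, clockwise, the
  timelike faces of the links at `v`;
* a red curve coloured by `zSs` for each link `e` of `Σ`, crossing, in this cyclic order, the
  timelike face below, the plaquette on the right, the timelike face above (the outgoing index) and
  the plaquette on the left.

The summation labels are those of the crossings: `a d` for the crossing of the plaquette on the left
of the dart `d` with the link of `d`, `c d` for the crossing of the timelike face over the link of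
`d` with the timelike link at the start of `d`, and `u e` for the crossing of the timelike face over
`e` with the top copy of `e`. -/
def transferMatrix (L : SurfaceLattice E) (b : Module.Basis ι ℂ A)
    (zT zS : A) (zTs zSs : DualAlg A) : Matrix (E → ι) (E → ι) ℂ :=
  Matrix.of fun out inp =>
    ∑ a : Dart E → ι, ∑ c : Dart E → ι, ∑ u : E → ι,
      (∏ p : L.Plaquette,
        blueWeight zS ((cycleList L.face p).map fun d => crossing d.2 (b (a d)))) *
      (∏ e : E,
        blueWeight zT
          [b (inp e), b (c (e, false)), crossing false (b (u e)),
            crossing false (b (c (e, true)))]) *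
      (∏ v : L.Vertex,
        redWeight zTs ((cycleList L.rot⁻¹ v).map fun d => dualVec b (c d))) *
      (∏ e : E,
        redWeight zSs
          [dualVec b (u e), dualVec b (a (e, false)), dualVec b (out e), dualVec b (a (e, true))])

/-! ### Plaquette and star operators -/

variable [DecidableEq ι]

/-- The operator on `A^{⊗ E}` acting by `g` on the tensor factor of the link `e`. -/
def siteOp (b : Module.Basis ι ℂ A) (e : E) (g : A →ₗ[ℂ] A) : Matrix (E → ι) (E → ι) ℂ :=
  Matrix.of fun i j =>
    LinearMap.toMatrix b b g (i e) (j e) *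
      ∏ e' ∈ Finset.univ.erase e, (1 : Matrix ι ι ℂ) (i e') (j e')

/-- `x ↦ ∑ x₁ f(x₂)`. -/
def evalRight (f : A →ₗ[ℂ] ℂ) : A →ₗ[ℂ] A :=
  (TensorProduct.rid ℂ A).toLinearMap ∘ₗ LinearMap.lTensor A f ∘ₗ Coalgebra.comul

/-- `x ↦ ∑ f(x₁) x₂`. -/
def evalLeft (f : A →ₗ[ℂ] ℂ) : A →ₗ[ℂ] A :=
  (TensorProduct.lid ℂ A).toLinearMap ∘ₗ LinearMap.rTensor A f ∘ₗ Coalgebra.comul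

/-- The leg of a plaquette operator on the link of the boundary dart `d`, the other end of the leg
being contracted with `f`: `x ↦ ∑ x₁ f(x₂)` if the link is run along its orientation (the plaquette
is on its left), and `x ↦ ∑ f(S x₁) x₂` if it is run backwards. -/
def plaquetteLeg (b : Module.Basis ι ℂ A) (d : Dart E) (f : A →ₗ[ℂ] ℂ) :
    Matrix (E → ι) (E → ι) ℂ :=
  siteOp b d.1 (if d.2 then evalRight f else evalLeft (f ∘ₗ HopfAlgebra.antipode ℂ))

/-- The leg of a star operator on the link of the dart `d` at the vertex, contracted with `h`:
`x ↦ S(h) x` if the link leaves the vertex, and `x ↦ x h` if it enters it. -/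
def starLeg (b : Module.Basis ι ℂ A) (d : Dart E) (h : A) : Matrix (E → ι) (E → ι) ℂ :=
  siteOp b d.1
    (if d.2 then LinearMap.mulLeft ℂ (HopfAlgebra.antipode ℂ h) else LinearMap.mulRight ℂ h)

/-- The contraction of the tensor `f (φ_{l₁} ⋯ φ_{l_k})` with the legs on the boundary of the
plaquette `p`, in cyclic order. -/
def plaquetteOpOf (L : SurfaceLattice E) (b : Module.Basis ι ℂ A) (f : A →ₗ[ℂ] ℂ)
    (p : L.Plaquette) : Matrix (E → ι) (E → ι) ℂ :=
  let ds := cycleList L.face p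
  ∑ l : Fin ds.length → ι,
    f (List.ofFn fun k => b (l k)).prod •
      (List.ofFn fun k => plaquetteLeg b (ds.get k) (b.coord (l k))).prod

/-- The contraction of the tensor `w (φ^{l₁} ⋯ φ^{l_k})` with the legs at the vertex `v`, in
(clockwise) cyclic order. -/
def starOpOf (L : SurfaceLattice E) (b : Module.Basis ι ℂ A) (w : DualAlg A →ₗ[ℂ] ℂ)
    (v : L.Vertex) : Matrix (E → ι) (E → ι) ℂ :=
  let ds := cycleList L.rot⁻¹ v
  ∑ l : Fin ds.length → ι,
    w (List.ofFn fun k => dualVec b (l k)).prod •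
      (List.ofFn fun k => starLeg b (ds.get k) (b (l k))).prod

/-- The plaquette operator `B_p(z)`, with weight `M = tr (z ⋯)`. -/
def plaquetteOp (L : SurfaceLattice E) (b : Module.Basis ι ℂ A) (z : A) (p : L.Plaquette) :
    Matrix (E → ι) (E → ι) ℂ :=
  plaquetteOpOf L b (tr A ∘ₗ LinearMap.mulLeft ℂ z) p

/-- The star operator `A_s(z*)`, with weight `Δ = cotr (z* ⋯)`. -/
def starOp (L : SurfaceLattice E) (b : Module.Basis ι ℂ A) (zs : DualAlg A) (v : L.Vertex) :
    Matrix (E → ι) (E → ι) ℂ :=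
  starOpOf L b (cotr A ∘ₗ LinearMap.mulLeft ℂ zs) v

/-! ### Hamiltonians and logarithms -/

/-- `H(γ_p, γ_s, γ) = -γ_p ∑_p (1 - (2/n) B_p⁰) - γ_s ∑_s (1 - (2/n) A_s⁰) - γ 1`. -/
def hamiltonian (L : SurfaceLattice E) (b : Module.Basis ι ℂ A) (γp γs γ : ℝ) :
    Matrix (E → ι) (E → ι) ℂ :=
  -((γp : ℂ) • ∑ p : L.Plaquette,
      (1 - (2 / (Module.finrank ℂ A : ℂ)) • plaquetteOp L b (1 : A) p)) -
    (γs : ℂ) • ∑ v : L.Vertex,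
      (1 - (2 / (Module.finrank ℂ A : ℂ)) • starOp L b (1 : DualAlg A) v) -
    (γ : ℂ) • 1

/-- The Hamiltonian `-J_s ∑_s A_s - J_p ∑_p B_p` of the quantum double model of `A`, where `A_s` is
the action of the Haar integral `h` of `A` at the vertex `s` (through its iterated coproduct) and
`B_p` the action of the Haar integral `φ` of `A*` on the plaquette `p`. -/
def quantumDoubleHamiltonian (L : SurfaceLattice E) (b : Module.Basis ι ℂ A) (h : A)
    (φ : DualAlg A) (Js Jp : ℝ) : Matrix (E → ι) (E → ι) ℂ :=
  -((Js : ℂ) • ∑ v : L.Vertex,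
      starOpOf L b (LinearMap.applyₗ h ∘ₗ (WithConv.linearEquiv ℂ (A →ₗ[ℂ] ℂ)).toLinearMap) v) -
    (Jp : ℂ) • ∑ p : L.Plaquette, plaquetteOpOf L b φ.ofConv p

/-- `X` is the principal logarithm of `U`: its exponential is `U` and its spectrum lies in the open
strip `|Im μ| < π` (such an `X` is unique when it exists). -/
def IsPrincipalLog {m : Type*} [Fintype m] [DecidableEq m] (U X : Matrix m m ℂ) : Prop :=
  NormedSpace.exp X = U ∧ ∀ μ ∈ spectrum ℂ X, -Real.pi < μ.im ∧ μ.im < Real.pi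

end Model

end HopfLattice

end

open HopfLattice

set_option linter.unusedSectionVars false

/-! Write `n = dim A`. Two elements control everything: the functional `tr`, and the element `ℓ =
cotrElement A` with `cotr f = f(ℓ)`. When `S² = 1`, cyclicity of the trace shows that `tr` is a
two-sided integral of the dual algebra and `ℓ` a two-sided co-integral of `A`, with `ε(ℓ) = tr(1) =
tr(ℓ) = n` (`tr_conv_mul`, `conv_mul_tr`, `mul_cotrElement`, `cotrElement_mul`). Comparing any other
integral with these shows that it is proportional to them, so the normalizations force `λ = ℓ` and
`Λ = tr`, and the Haar integrals are `ℓ/n` and `tr/n`.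

Factorization. The label `u e` occurs only in the weight of the timelike face over `e` and in that
of the link `e`. When both carry trivial colours it is summed by `∑ tr(y S(ℓ₁)) f(ℓ₂) = n f(y)`
(`sum_tr_antipode_mul`), which follows from the Frobenius property of `ℓ`. Each link thus yields a
factor `n` and the composite of two star legs followed by two plaquette legs (`sum_link_weights`).
The remaining labels sit on the darts; the face cycles, and likewise the vertex cycles, partition
the darts, so these sums are the expanded products of the operators (`noncommProd_cycles_eq_sum`,
`transferMatrix_eq`).

Commutation. Legs on distinct darts commute within each type, by coassociativity or associativity.
To move a star operator past a plaquette operator, carry it through leg by leg: the leg at `d`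
absorbs a letter `h` standing before `d` in the plaquette word and emits one after the flipped dart.
The face successor of the flipped dart is the next dart round the vertex, so the letters telescope
(`insert_mul_prod_eq`). What survives is a conjugation at one corner, removed by the trace property
of the plaquette weight and the cocommutativity of the star weight (`contract_commute_starConv`).

Logarithm. Star and plaquette operators at a fixed place multiply like elements of `A` (in reversed
order) and of its dual. Hence `tr * tr = n tr` and `ℓ ℓ = n ℓ` make `B_p⁰/n` and `A_s⁰/n` commuting
idempotents `P`. The mixtures give `δ (1 - P) + (2 - δ) P`, the exponential of `ln δ (1 - P) + ln (2
- δ) P`. Adding these logarithms gives `-H`; a real combination of commuting idempotents has real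
spectrum, so the logarithm is principal. -/

noncomputable section

namespace HopfLattice

open Coalgebra HopfAlgebra TensorProduct WithConv

/-! ### Partial evaluations of the coproduct -/

section HopfIdentities

variable {A : Type*} [Ring A] [HopfAlgebra ℂ A]

lemma evalRight_eq_sum {x : A} {κ : Type*} (r : Repr ℂ x κ) (f : A →ₗ[ℂ] ℂ) :
    evalRight f x = ∑ i ∈ r.index, f (r.right i) • r.left i := by
  simp [evalRight, ← r.eq]

lemma evalLeft_eq_sum {x : A} {κ : Type*} (r : Repr ℂ x κ) (f : A →ₗ[ℂ] ℂ) :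
    evalLeft f x = ∑ i ∈ r.index, f (r.left i) • r.right i := by
  simp [evalLeft, ← r.eq]

lemma dual_mul_apply_evalRight (f g : DualAlg A) (x : A) :
    (f * g) x = f (evalRight g.ofConv x) := by
  rw [(ℛ ℂ x).convMul_apply, evalRight_eq_sum (ℛ ℂ x)]
  simp [mul_comm]

lemma dual_mul_apply_evalLeft (f g : DualAlg A) (x : A) :
    (f * g) x = g (evalLeft f.ofConv x) := by
  rw [(ℛ ℂ x).convMul_apply, evalLeft_eq_sum (ℛ ℂ x)]
  simp

lemma evalRight_counit : evalRight (A := A) (counit (R := ℂ)) = LinearMap.id := by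
  ext x
  rw [evalRight]
  simp

lemma evalLeft_counit : evalLeft (A := A) (counit (R := ℂ)) = LinearMap.id := by
  ext x
  rw [evalLeft]
  simp

/-- `evalRight` as a linear map in the functional. -/
def evalRightLin : (A →ₗ[ℂ] ℂ) →ₗ[ℂ] (A →ₗ[ℂ] A) where
  toFun f := evalRight f
  map_add' f g := by ext x; simp [evalRight_eq_sum (ℛ ℂ x), add_smul, Finset.sum_add_distrib]
  map_smul' c f := by ext x; simp [evalRight_eq_sum (ℛ ℂ x), mul_smul, Finset.smul_sum]

/-- `evalLeft` as a linear map in the functional. -/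
def evalLeftLin : (A →ₗ[ℂ] ℂ) →ₗ[ℂ] (A →ₗ[ℂ] A) where
  toFun f := evalLeft f
  map_add' f g := by ext x; simp [evalLeft_eq_sum (ℛ ℂ x), add_smul, Finset.sum_add_distrib]
  map_smul' c f := by ext x; simp [evalLeft_eq_sum (ℛ ℂ x), mul_smul, Finset.smul_sum]

lemma ext_dual {V : Type*} [AddCommGroup V] [Module ℂ V] {x y : V}
    (h : ∀ f : V →ₗ[ℂ] ℂ, f x = f y) : x = y := by
  rw [← sub_eq_zero]
  refine (Module.forall_dual_apply_eq_zero_iff ℂ (x - y)).1 fun f => ?_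
  rw [map_sub, h f, sub_self]

/-- Tested against a functional `k`, coassociativity becomes associativity of the convolution
product. The next two lemmas hold for the same reason. -/
lemma evalRight_comp_evalRight (f g : DualAlg A) :
    evalRight f.ofConv ∘ₗ evalRight g.ofConv = evalRight (f * g).ofConv := by
  ext x
  refine ext_dual fun k => ?_
  have := congr($(mul_assoc (toConv k) f g) x)
  simp only [dual_mul_apply_evalRight] at this ⊢
  exact this

lemma evalLeft_comp_evalLeft (f g : DualAlg A) :
    evalLeft f.ofConv ∘ₗ evalLeft g.ofConv = evalLeft (g * f).ofConv := by
  ext x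
  refine ext_dual fun k => ?_
  have := congr($(mul_assoc g f (toConv k)) x)
  simp only [dual_mul_apply_evalLeft] at this ⊢
  exact this.symm

lemma evalRight_evalLeft_comm (f g : A →ₗ[ℂ] ℂ) :
    evalRight f ∘ₗ evalLeft g = evalLeft g ∘ₗ evalRight f := by
  ext x
  refine ext_dual fun k => ?_
  have := congr($(mul_assoc (toConv g) (toConv k) (toConv f)) x)
  rw [dual_mul_apply_evalRight, dual_mul_apply_evalLeft, dual_mul_apply_evalLeft,
    dual_mul_apply_evalRight] at this
  exact this.symm

/-- Multiplicativity of `Δ`. The four variants keep explicit the coproduct of whichever factor has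
to be carried past the evaluation. -/
lemma evalRight_mul {x y : A} {κ : Type*} (r : Repr ℂ y κ) (f : A →ₗ[ℂ] ℂ) :
    evalRight f (x * y) =
      ∑ j ∈ r.index, evalRight (f ∘ₗ LinearMap.mulRight ℂ (r.right j)) x * r.left j := by
  rw [evalRight_eq_sum ((ℛ ℂ x).mul r)]
  simp only [evalRight_eq_sum (ℛ ℂ x)]
  rw [Repr.mul_index, Finset.sum_product_right]
  simp [Finset.sum_mul]

lemma evalLeft_mul {x y : A} {κ : Type*} (r : Repr ℂ y κ) (f : A →ₗ[ℂ] ℂ) :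
    evalLeft f (x * y) =
      ∑ j ∈ r.index, evalLeft (f ∘ₗ LinearMap.mulRight ℂ (r.left j)) x * r.right j := by
  rw [evalLeft_eq_sum ((ℛ ℂ x).mul r)]
  simp only [evalLeft_eq_sum (ℛ ℂ x)]
  rw [Repr.mul_index, Finset.sum_product_right]
  simp [Finset.sum_mul]

lemma evalRight_mul' {x y : A} {κ : Type*} (r : Repr ℂ x κ) (f : A →ₗ[ℂ] ℂ) :
    evalRight f (x * y) =
      ∑ j ∈ r.index, r.left j * evalRight (f ∘ₗ LinearMap.mulLeft ℂ (r.right j)) y := by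
  rw [evalRight_eq_sum (r.mul (ℛ ℂ y))]
  simp only [evalRight_eq_sum (ℛ ℂ y)]
  rw [Repr.mul_index, Finset.sum_product]
  simp [Finset.mul_sum]

lemma evalLeft_mul' {x y : A} {κ : Type*} (r : Repr ℂ x κ) (f : A →ₗ[ℂ] ℂ) :
    evalLeft f (x * y) =
      ∑ j ∈ r.index, r.right j * evalLeft (f ∘ₗ LinearMap.mulLeft ℂ (r.left j)) y := by
  rw [evalLeft_eq_sum (r.mul (ℛ ℂ y))]
  simp only [evalLeft_eq_sum (ℛ ℂ y)]
  rw [Repr.mul_index, Finset.sum_product]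
  simp [Finset.mul_sum]

end HopfIdentities

/-! ### Cancellation by the antipode inside iterated coproducts -/

section Cancellation

variable {A : Type*} [Ring A] [HopfAlgebra ℂ A]

/-- A bilinear operation inverting the comultiplication: `∑ m(x₁, x₂) = ε(x) 1`. -/
def Cancels (m : A →ₗ[ℂ] A →ₗ[ℂ] A) : Prop :=
  ∀ x : A, TensorProduct.lift m (comul (R := ℂ) x) = counit (R := ℂ) x • (1 : A)

/-- Coassociativity brings the last two of three coproduct legs together, where `m` collapses them:
`x₁ ⊗ m(x₂, x₃) = x ⊗ 1`. The nested choice of representatives is the one that the product rules for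
`evalRight` and `evalLeft` produce. -/
lemma sum_tmul_cancel {m : A →ₗ[ℂ] A →ₗ[ℂ] A} (hm : Cancels m) (x : A) :
    ∑ i ∈ (ℛ ℂ x).index, ∑ j ∈ (ℛ ℂ ((ℛ ℂ x).left i)).index,
      (ℛ ℂ ((ℛ ℂ x).left i)).left j ⊗ₜ[ℂ] m ((ℛ ℂ ((ℛ ℂ x).left i)).right j) ((ℛ ℂ x).right i) =
      x ⊗ₜ 1 := by
  have h := congr(LinearMap.lTensor A (TensorProduct.lift m)
    $(sum_tmul_tmul_eq (R := ℂ) (ℛ ℂ x) (fun i => ℛ ℂ _) (fun i => ℛ ℂ _)))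
  simp only [map_sum, LinearMap.lTensor_tmul, TensorProduct.lift.tmul] at h
  rw [h]
  have h2 : ∀ z : A, ∑ j ∈ (ℛ ℂ z).index, m ((ℛ ℂ z).left j) ((ℛ ℂ z).right j) =
      counit (R := ℂ) z • (1 : A) := fun z => by
    rw [← hm z, ← (ℛ ℂ z).eq]; simp
  simp only [← TensorProduct.tmul_sum, h2]
  have h3 := congr(LinearMap.lTensor A (LinearMap.toSpanSingleton ℂ A 1)
    $(sum_tmul_counit_eq (ℛ ℂ x)))
  simpa only [map_sum, LinearMap.lTensor_tmul, LinearMap.toSpanSingleton_apply, one_smul] using h3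

lemma sum_cancel_tmul {m : A →ₗ[ℂ] A →ₗ[ℂ] A} (hm : Cancels m) (x : A) :
    ∑ i ∈ (ℛ ℂ x).index, ∑ j ∈ (ℛ ℂ ((ℛ ℂ x).right i)).index,
      m ((ℛ ℂ x).left i) ((ℛ ℂ ((ℛ ℂ x).right i)).left j) ⊗ₜ[ℂ]
        (ℛ ℂ ((ℛ ℂ x).right i)).right j = 1 ⊗ₜ x := by
  have h := congr((LinearMap.rTensor A (TensorProduct.lift m) ∘ₗ
      (TensorProduct.assoc ℂ A A A).symm.toLinearMap)
    $(sum_tmul_tmul_eq (R := ℂ) (ℛ ℂ x) (fun i => ℛ ℂ _) (fun i => ℛ ℂ _)))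
  simp only [map_sum, LinearMap.comp_apply, LinearEquiv.coe_coe, TensorProduct.assoc_symm_tmul,
    LinearMap.rTensor_tmul, TensorProduct.lift.tmul] at h
  rw [← h]
  have h2 : ∀ z : A, ∑ j ∈ (ℛ ℂ z).index, m ((ℛ ℂ z).left j) ((ℛ ℂ z).right j) =
      counit (R := ℂ) z • (1 : A) := fun z => by
    rw [← hm z, ← (ℛ ℂ z).eq]; simp
  simp only [← TensorProduct.sum_tmul, h2]
  have h3 := congr(LinearMap.rTensor A (LinearMap.toSpanSingleton ℂ A 1)
    $(sum_counit_tmul_eq (ℛ ℂ x)))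
  simpa only [map_sum, LinearMap.rTensor_tmul, LinearMap.toSpanSingleton_apply, one_smul] using h3

/-- `(x, y) ↦ x S(y)`. -/
def mulAntipode : A →ₗ[ℂ] A →ₗ[ℂ] A := (LinearMap.mul ℂ A).compl₂ (antipode ℂ)

/-- `(x, y) ↦ S(x) y`. -/
def antipodeMul : A →ₗ[ℂ] A →ₗ[ℂ] A := LinearMap.mul ℂ A ∘ₗ antipode ℂ

@[simp] lemma mulAntipode_apply (x y : A) : mulAntipode x y = x * antipode ℂ y := rfl
@[simp] lemma antipodeMul_apply (x y : A) : antipodeMul x y = antipode ℂ x * y := rfl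

lemma cancels_mulAntipode : Cancels (mulAntipode (A := A)) := fun x => by
  rw [← sum_mul_antipode_eq_smul (ℛ ℂ x), ← (ℛ ℂ x).eq]
  simp

lemma cancels_antipodeMul : Cancels (antipodeMul (A := A)) := fun x => by
  rw [← sum_antipode_mul_eq_smul (ℛ ℂ x), ← (ℛ ℂ x).eq]
  simp

/-- Apply `S` to `x₁ S(x₂) = ε(x) 1`: antimultiplicativity and `S² = 1` turn the left side into `x₂
S(x₁)`. -/
lemma cancels_mulAntipode_flip (hA : IsInvolutory A) :
    Cancels (mulAntipode (A := A)).flip := fun x => by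
  have h := congr(antipode ℂ $(sum_mul_antipode_eq_smul (ℛ ℂ x)))
  rw [map_smul, antipode_one] at h
  rw [← h, ← (ℛ ℂ x).eq]
  simp [antipode_mul_antidistrib, hA _]

lemma cancels_antipodeMul_flip (hA : IsInvolutory A) :
    Cancels (antipodeMul (A := A)).flip := fun x => by
  have h := congr(antipode ℂ $(sum_antipode_mul_eq_smul (ℛ ℂ x)))
  rw [map_smul, antipode_one] at h
  rw [← h, ← (ℛ ℂ x).eq]
  simp [antipode_mul_antidistrib, hA _]

end Cancellation

/-! ### The antipode reverses the coproduct -/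

section AntipodeComul

variable {A : Type*} [Ring A] [HopfAlgebra ℂ A]

lemma antipode_algHom_conv {N : Type*} [Semiring N] [Algebra ℂ N] (i : A →ₐ[ℂ] N) :
    toConv (i.toLinearMap ∘ₗ antipode ℂ) * toConv i.toLinearMap = 1 := by
  have h := congr(toConv (i.toLinearMap ∘ₗ WithConv.ofConv $(LinearMap.antipode_mul_id (R := ℂ) (C := A))))
  rw [LinearMap.algHom_comp_convMul_distrib] at h
  refine Eq.trans ?_ (h.trans ?_)
  · rfl
  · ext x; simp

lemma comul_eq_conv : toConv (comul (R := ℂ) (A := A)) =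
    toConv (Algebra.TensorProduct.includeLeft : A →ₐ[ℂ] A ⊗[ℂ] A).toLinearMap *
      toConv (Algebra.TensorProduct.includeRight : A →ₐ[ℂ] A ⊗[ℂ] A).toLinearMap := by
  ext x
  rw [(ℛ ℂ x).convMul_apply, ofConv_toConv, ← (ℛ ℂ x).eq]
  simp

/-- Both sides are convolution inverses of `Δ`: `Δ` is the product of the two inclusions of `A` into
`A ⊗ A`, and each inclusion is inverted by composing with `S`. -/
lemma comul_antipode_eq_conv : toConv (comul (R := ℂ) (A := A) ∘ₗ antipode ℂ) =
    toConv ((Algebra.TensorProduct.includeRight : A →ₐ[ℂ] A ⊗[ℂ] A).toLinearMap ∘ₗ antipode ℂ) *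
      toConv ((Algebra.TensorProduct.includeLeft : A →ₐ[ℂ] A ⊗[ℂ] A).toLinearMap ∘ₗ antipode ℂ) := by
  have h : (toConv ((Algebra.TensorProduct.includeRight : A →ₐ[ℂ] A ⊗[ℂ] A).toLinearMap ∘ₗ
        antipode ℂ) *
      toConv ((Algebra.TensorProduct.includeLeft : A →ₐ[ℂ] A ⊗[ℂ] A).toLinearMap ∘ₗ antipode ℂ)) *
      toConv (comul (R := ℂ) (A := A)) = 1 := by
    have aux : ∀ a a' c c' : WithConv (A →ₗ[ℂ] A ⊗[ℂ] A), a' * a = 1 → c' * c = 1 →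
        c' * a' * (a * c) = 1 := fun a a' c c' h1 h2 => by
      rw [mul_assoc, ← mul_assoc a', h1, one_mul, h2]
    rw [comul_eq_conv]
    exact aux _ _ _ _ (antipode_algHom_conv _) (antipode_algHom_conv _)
  exact left_inv_eq_right_inv h LinearMap.comul_right_inv |>.symm

lemma comul_antipode (x : A) : comul (R := ℂ) (antipode ℂ x) =
    ∑ i ∈ (ℛ ℂ x).index, antipode ℂ ((ℛ ℂ x).right i) ⊗ₜ[ℂ] antipode ℂ ((ℛ ℂ x).left i) := by
  have h := congr($(comul_antipode_eq_conv) x)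
  rw [(ℛ ℂ x).convMul_apply] at h
  simpa using h

end AntipodeComul

/-! ### Regular traces as integrals, and uniqueness of integrals -/

section Trace

variable {A : Type*} [Ring A] [HopfAlgebra ℂ A]

lemma tr_apply (x : A) : tr A x = LinearMap.trace ℂ A (LinearMap.mulLeft ℂ x) := rfl

lemma tr_mul_comm (x y : A) : tr A (x * y) = tr A (y * x) := by
  simp only [tr_apply, LinearMap.mulLeft_mul]
  exact LinearMap.trace_mul_comm ℂ _ _

lemma cotr_mul_comm (f g : DualAlg A) : cotr A (f * g) = cotr A (g * f) := by
  change LinearMap.trace ℂ _ (LinearMap.mul ℂ _ (f * g)) =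
    LinearMap.trace ℂ _ (LinearMap.mul ℂ _ (g * f))
  have h : ∀ f g : DualAlg A, LinearMap.mul ℂ (DualAlg A) (f * g) =
      LinearMap.mul ℂ (DualAlg A) f * LinearMap.mul ℂ (DualAlg A) g := fun f g => by
    ext1 k; exact mul_assoc f g k
  rw [h, h]
  exact LinearMap.trace_mul_comm ℂ _ _

variable {ι : Type*} [Fintype ι] (b : Module.Basis ι ℂ A)

lemma sum_coord_smul {V : Type*} [AddCommGroup V] [Module ℂ V] (F : A →ₗ[ℂ] V) (v : A) :
    ∑ i, b.coord i v • F (b i) = F v := by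
  conv_rhs => rw [← b.sum_repr v, map_sum]
  simp

/-- `v ↦ f(· v)`. -/
def mulRightDual (f : A →ₗ[ℂ] ℂ) : A →ₗ[ℂ] (A →ₗ[ℂ] ℂ) :=
  ((LinearMap.mul ℂ A).flip).compr₂ f

/-- `v ↦ f(v ·)`. -/
def mulLeftDual (f : A →ₗ[ℂ] ℂ) : A →ₗ[ℂ] (A →ₗ[ℂ] ℂ) :=
  (LinearMap.mul ℂ A).compr₂ f

@[simp] lemma mulRightDual_apply (f : A →ₗ[ℂ] ℂ) (v x : A) : mulRightDual f v x = f (x * v) := rfl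
@[simp] lemma mulLeftDual_apply (f : A →ₗ[ℂ] ℂ) (v x : A) : mulLeftDual f v x = f (v * x) := rfl

/-- The linear map `u ⊗ v ↦ Φ(v)(x) u` associated with a linear family `Φ` of endomorphisms. -/
def familyMulRight (Φ : A →ₗ[ℂ] (A →ₗ[ℂ] A)) (x : A) : A ⊗[ℂ] A →ₗ[ℂ] A :=
  TensorProduct.lift (((LinearMap.mul ℂ A).flip).compl₂ (Φ.flip x))

@[simp] lemma familyMulRight_tmul (Φ : A →ₗ[ℂ] (A →ₗ[ℂ] A)) (x u v : A) :
    familyMulRight Φ x (u ⊗ₜ v) = Φ v x * u := rfl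

/-- The linear map `u ⊗ v ↦ u Φ(v)(x)` associated with a linear family `Φ` of endomorphisms. -/
def familyMulLeft (Φ : A →ₗ[ℂ] (A →ₗ[ℂ] A)) (x : A) : A ⊗[ℂ] A →ₗ[ℂ] A :=
  TensorProduct.lift ((LinearMap.mul ℂ A).compl₂ (Φ.flip x))

@[simp] lemma familyMulLeft_tmul (Φ : A →ₗ[ℂ] (A →ₗ[ℂ] A)) (x u v : A) :
    familyMulLeft Φ x (u ⊗ₜ v) = u * Φ v x := rfl

lemma sum_family_evalRight (Φ : A →ₗ[ℂ] (A →ₗ[ℂ] A)) (T M : A →ₗ[ℂ] A) (y : A) :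
    ∑ i, Φ (b i) (M (evalRight (b.coord i ∘ₗ T) y)) =
      ∑ j ∈ (ℛ ℂ y).index, Φ (T ((ℛ ℂ y).right j)) (M ((ℛ ℂ y).left j)) := by
  simp only [evalRight_eq_sum (ℛ ℂ y), map_sum, map_smul, LinearMap.comp_apply]
  rw [Finset.sum_comm]
  refine Finset.sum_congr rfl fun j _ => ?_
  exact sum_coord_smul b (Φ.flip (M ((ℛ ℂ y).left j))) (T ((ℛ ℂ y).right j))

lemma sum_family_evalLeft (Φ : A →ₗ[ℂ] (A →ₗ[ℂ] A)) (T M : A →ₗ[ℂ] A) (y : A) :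
    ∑ i, Φ (b i) (M (evalLeft (b.coord i ∘ₗ T) y)) =
      ∑ j ∈ (ℛ ℂ y).index, Φ (T ((ℛ ℂ y).left j)) (M ((ℛ ℂ y).right j)) := by
  simp only [evalLeft_eq_sum (ℛ ℂ y), map_sum, map_smul, LinearMap.comp_apply]
  rw [Finset.sum_comm]
  refine Finset.sum_congr rfl fun j _ => ?_
  exact sum_coord_smul b (Φ.flip (M ((ℛ ℂ y).right j))) (T ((ℛ ℂ y).left j))

lemma mulRightDual_one (f : A →ₗ[ℂ] ℂ) : mulRightDual f 1 = f := by ext; simp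
lemma mulLeftDual_one (f : A →ₗ[ℂ] ℂ) : mulLeftDual f 1 = f := by ext; simp

lemma comp_sum_eq {κ : Type*} (s : Finset κ) (P : A →ₗ[ℂ] A) (Q : κ → (A →ₗ[ℂ] A)) :
    P ∘ₗ ∑ i ∈ s, Q i = ∑ i ∈ s, P ∘ₗ Q i := by
  ext; simp

lemma sum_trace_comp_comm {κ : Type*} (s : Finset κ) (P Q : κ → (A →ₗ[ℂ] A)) :
    LinearMap.trace ℂ A (∑ i ∈ s, P i ∘ₗ Q i) = LinearMap.trace ℂ A (∑ i ∈ s, Q i ∘ₗ P i) := by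
  simp only [map_sum]
  exact Finset.sum_congr rfl fun i _ => LinearMap.trace_mul_comm ℂ (P i) (Q i)

lemma mulRightDual_mul (f : A →ₗ[ℂ] ℂ) (u v : A) :
    mulRightDual f (u * v) = mulRightDual f v ∘ₗ LinearMap.mulRight ℂ u := by
  ext; simp [mul_assoc]

lemma mulLeftDual_mul (f : A →ₗ[ℂ] ℂ) (u v : A) :
    mulLeftDual f (u * v) = mulLeftDual f u ∘ₗ LinearMap.mulLeft ℂ v := by
  ext; simp [mul_assoc]

lemma sum_coord_mul_mulRightDual (f : A →ₗ[ℂ] ℂ) (u v : A) :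
    ∑ i, b.coord i u * mulRightDual f (b i) v = f (v * u) := by
  simpa using sum_coord_smul b (f ∘ₗ LinearMap.mulLeft ℂ v) u

lemma Cancels.sum_eq {m : A →ₗ[ℂ] A →ₗ[ℂ] A} (hm : Cancels m) (x : A) :
    ∑ j ∈ (ℛ ℂ x).index, m ((ℛ ℂ x).left j) ((ℛ ℂ x).right j) = counit (R := ℂ) x • (1 : A) := by
  rw [← hm x, ← (ℛ ℂ x).eq]; simp

/-- The sum is the functional `y ↦ f(y₂ S(y₁))`, in the order in which it appears once a trace has
been cycled. -/
lemma sum_coord_antipode_conv (hA : IsInvolutory A) (f : A →ₗ[ℂ] ℂ) :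
    ∑ i, toConv (b.coord i ∘ₗ antipode ℂ) * toConv (mulRightDual f (b i)) =
      f 1 • (1 : DualAlg A) := by
  ext y
  simp only [ofConv_sum, LinearMap.sum_apply, (ℛ ℂ y).convMul_apply, LinearMap.comp_apply]
  rw [Finset.sum_comm]
  simp only [sum_coord_mul_mulRightDual]
  have := congr(f $((cancels_mulAntipode_flip hA).sum_eq y))
  simpa [mul_comm] using this

lemma sum_conv_coord_antipode (f : A →ₗ[ℂ] ℂ) :
    ∑ i, toConv (mulRightDual f (b i)) * toConv (b.coord i ∘ₗ antipode ℂ) =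
      f 1 • (1 : DualAlg A) := by
  ext y
  simp only [ofConv_sum, LinearMap.sum_apply, (ℛ ℂ y).convMul_apply, LinearMap.comp_apply]
  rw [Finset.sum_comm]
  simp only [mul_comm (mulRightDual _ _ _), sum_coord_mul_mulRightDual]
  have := congr(f $((cancels_mulAntipode).sum_eq y))
  simpa [mul_comm] using this

/-- The regular trace is a right integral in the dual algebra. -/
lemma tr_conv_mul [Module.Finite ℂ A] (hA : IsInvolutory A) (f : DualAlg A) :
    toConv (tr A) * f = f 1 • toConv (tr A) := by
  let b := Module.finBasis ℂ A
  ext x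
  rw [dual_mul_apply_evalRight]
  change tr A _ = f 1 • tr A x
  -- Since `y₂ S(y₃)` cancels, `x₁ f(x₂) y = x₁ y₁ f(x₂ y₂ S(y₃))`: first a coproduct of `y`, then
  -- multiplication by `x`, then a coproduct of the product. The basis carries `S(y₃)` from the
  -- first map to the last.
  have key : LinearMap.mulLeft ℂ (evalRight f.ofConv x) = ∑ i,
      evalRight (mulRightDual f.ofConv (b i)) ∘ₗ (LinearMap.mulLeft ℂ x ∘ₗ
        evalRight (b.coord i ∘ₗ antipode ℂ)) := by
    ext y
    have h := congr(familyMulRight (evalRightLin ∘ₗ mulRightDual f.ofConv) x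
      $(sum_tmul_cancel cancels_mulAntipode y))
    simp only [map_sum, familyMulRight_tmul, LinearMap.comp_apply, mulAntipode_apply,
      mulRightDual_one] at h
    refine h.symm.trans ?_
    rw [LinearMap.sum_apply]
    refine Eq.trans ?_ (sum_family_evalRight b (evalRightLin ∘ₗ mulRightDual f.ofConv)
      (antipode ℂ) (LinearMap.mulLeft ℂ x) y).symm
    refine Finset.sum_congr rfl fun j _ => ?_
    rw [LinearMap.mulLeft_apply]
    refine Eq.trans ?_ (evalRight_mul (ℛ ℂ ((ℛ ℂ y).left j)) _).symm
    refine Finset.sum_congr rfl fun k _ => ?_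
    rw [mulRightDual_mul]
    rfl
  -- After cycling, the two coproduct maps are adjacent and compose to evaluation against `y ↦ f(y₂
  -- S(y₁)) = f(1) ε(y)`; this is where `S² = 1` enters.
  have key2 : ∑ i, (LinearMap.mulLeft ℂ x ∘ₗ evalRight (b.coord i ∘ₗ antipode ℂ)) ∘ₗ
      evalRight (mulRightDual f.ofConv (b i)) = f 1 • LinearMap.mulLeft ℂ x := by
    have := congr(LinearMap.mulLeft ℂ x ∘ₗ evalRightLin (WithConv.ofConv
      $(sum_coord_antipode_conv b hA f.ofConv)))
    rw [ofConv_sum, map_sum, comp_sum_eq] at this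
    refine Eq.trans ?_ (this.trans ?_)
    · refine Finset.sum_congr rfl fun i _ => ?_
      rw [LinearMap.comp_assoc]
      exact congrArg _ (evalRight_comp_evalRight _ _)
    · rw [ofConv_smul, map_smul]
      change _ ∘ₗ (f 1 • evalRight (counit (R := ℂ))) = _
      rw [evalRight_counit, LinearMap.comp_smul, LinearMap.comp_id]
  rw [tr_apply, key, sum_trace_comp_comm, key2, map_smul]
  rfl

/-- The regular trace is a left integral in the dual algebra. -/
lemma conv_mul_tr [Module.Finite ℂ A] (hA : IsInvolutory A) (f : DualAlg A) :
    f * toConv (tr A) = f 1 • toConv (tr A) := by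
  let b := Module.finBasis ℂ A
  ext x
  rw [dual_mul_apply_evalLeft]
  change tr A _ = f 1 • tr A x
  -- The mirror image `f(x₁) x₂ y = f(x₁ y₂ S(y₁)) x₂ y₃`. Here the decomposition needs `S² = 1`,
  -- and the cycled identity only the antipode axiom.
  have key : LinearMap.mulLeft ℂ (evalLeft f.ofConv x) = ∑ i,
      evalLeft (mulRightDual f.ofConv (b i)) ∘ₗ (LinearMap.mulLeft ℂ x ∘ₗ
        evalLeft (b.coord i ∘ₗ antipode ℂ)) := by
    ext y
    have h := congr((familyMulRight (evalLeftLin ∘ₗ mulRightDual f.ofConv) x ∘ₗ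
      (TensorProduct.comm ℂ A A).toLinearMap)
      $(sum_cancel_tmul (cancels_mulAntipode_flip hA) y))
    simp only [map_sum, familyMulRight_tmul, LinearMap.comp_apply, mulAntipode_apply,
      mulRightDual_one, LinearEquiv.coe_coe, TensorProduct.comm_tmul, LinearMap.flip_apply] at h
    refine h.symm.trans ?_
    rw [LinearMap.sum_apply]
    refine Eq.trans ?_ (sum_family_evalLeft b (evalLeftLin ∘ₗ mulRightDual f.ofConv)
      (antipode ℂ) (LinearMap.mulLeft ℂ x) y).symm
    refine Finset.sum_congr rfl fun j _ => ?_
    rw [LinearMap.mulLeft_apply]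
    refine Eq.trans ?_ (evalLeft_mul (ℛ ℂ ((ℛ ℂ y).right j)) _).symm
    refine Finset.sum_congr rfl fun k _ => ?_
    rw [mulRightDual_mul]
    rfl
  have key2 : ∑ i, (LinearMap.mulLeft ℂ x ∘ₗ evalLeft (b.coord i ∘ₗ antipode ℂ)) ∘ₗ
      evalLeft (mulRightDual f.ofConv (b i)) = f 1 • LinearMap.mulLeft ℂ x := by
    have := congr(LinearMap.mulLeft ℂ x ∘ₗ evalLeftLin (WithConv.ofConv
      $(sum_conv_coord_antipode b f.ofConv)))
    rw [ofConv_sum, map_sum, comp_sum_eq] at this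
    refine Eq.trans ?_ (this.trans ?_)
    · refine Finset.sum_congr rfl fun i _ => ?_
      rw [LinearMap.comp_assoc]
      exact congrArg _ (evalLeft_comp_evalLeft _ _)
    · rw [ofConv_smul, map_smul]
      change _ ∘ₗ (f 1 • evalLeft (counit (R := ℂ))) = _
      rw [evalLeft_counit, LinearMap.comp_smul, LinearMap.comp_id]
  rw [tr_apply, key, sum_trace_comp_comm, key2, map_smul]
  rfl

variable (A) in
/-- The element of `A` representing the co-trace. -/
def cotrElement [Module.Finite ℂ A] : A :=
  ∑ i, evalRight ((Module.finBasis ℂ A).coord i) (Module.finBasis ℂ A i)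

/-- Both sides are `∑ (f * bⁱ)(bᵢ)`: the convolution product may be evaluated on either factor. -/
lemma apply_cotrElement [Module.Finite ℂ A] (f : A →ₗ[ℂ] ℂ) :
    f (cotrElement A) = LinearMap.trace ℂ A (evalLeft f) := by
  rw [LinearMap.trace_eq_matrix_trace ℂ (Module.finBasis ℂ A), cotrElement, map_sum, Matrix.trace]
  refine Finset.sum_congr rfl fun i _ => ?_
  rw [Matrix.diag_apply, LinearMap.toMatrix_apply]
  have h := dual_mul_apply_evalRight (toConv f) (toConv ((Module.finBasis ℂ A).coord i))
    (Module.finBasis ℂ A i)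
  rw [dual_mul_apply_evalLeft] at h
  exact h.symm

/-- Convolution by `f` on the left is the transpose of `evalLeft f`, and transposition preserves the
trace. -/
lemma cotr_eq [Module.Finite ℂ A] (f : DualAlg A) : cotr A f = f (cotrElement A) := by
  rw [apply_cotrElement, ← LinearMap.trace_transpose']
  change LinearMap.trace ℂ (DualAlg A) (LinearMap.mul ℂ (DualAlg A) f) = _
  rw [← LinearMap.trace_conj' _ (WithConv.linearEquiv ℂ (A →ₗ[ℂ] ℂ))]
  congr 1
  ext g x
  exact dual_mul_apply_evalLeft f (toConv g) x

lemma mul_cotrElement [Module.Finite ℂ A] (hA : IsInvolutory A) (x : A) :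
    x * cotrElement A = counit (R := ℂ) x • cotrElement A := by
  refine ext_dual fun f => ?_
  -- Inserting the cancelling pair `S(x₃) x₂` gives `f(x y₁) y₂ = S(x₃) f(x₁ y₁) x₂ y₂`. Cycling the
  -- outer `S` then puts it next to the inner multiplication, where `x₁ S(x₂)` cancels.
  have key : evalLeft (mulLeftDual f x) = ∑ j ∈ (ℛ ℂ x).index,
      LinearMap.mulLeft ℂ (antipode ℂ ((ℛ ℂ x).right j)) ∘ₗ
        (evalLeft f ∘ₗ LinearMap.mulLeft ℂ ((ℛ ℂ x).left j)) := by
    ext y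
    have h := congr((familyMulLeft (evalLeftLin ∘ₗ mulLeftDual f) y ∘ₗ
      (TensorProduct.comm ℂ A A).toLinearMap)
      $(sum_tmul_cancel (cancels_antipodeMul_flip hA) x))
    simp only [map_sum, familyMulLeft_tmul, LinearMap.comp_apply, antipodeMul_apply,
      LinearEquiv.coe_coe, TensorProduct.comm_tmul, LinearMap.flip_apply, one_mul] at h
    refine h.symm.trans ?_
    rw [LinearMap.sum_apply]
    refine Finset.sum_congr rfl fun j _ => ?_
    simp only [LinearMap.comp_apply, LinearMap.mulLeft_apply]
    rw [evalLeft_mul' (ℛ ℂ ((ℛ ℂ x).left j)), Finset.mul_sum]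
    refine Finset.sum_congr rfl fun k _ => ?_
    rw [mul_assoc]
    rfl
  have key2 : ∑ j ∈ (ℛ ℂ x).index, (evalLeft f ∘ₗ LinearMap.mulLeft ℂ ((ℛ ℂ x).left j)) ∘ₗ
      LinearMap.mulLeft ℂ (antipode ℂ ((ℛ ℂ x).right j)) = counit (R := ℂ) x • evalLeft f := by
    ext y
    have := congr(evalLeft f ($((cancels_mulAntipode).sum_eq x) * y))
    simpa [Finset.sum_mul, mul_assoc] using this
  change mulLeftDual f x (cotrElement A) = _
  rw [apply_cotrElement, key, sum_trace_comp_comm, key2, map_smul, map_smul, apply_cotrElement]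

lemma cotrElement_mul [Module.Finite ℂ A] (hA : IsInvolutory A) (x : A) :
    cotrElement A * x = counit (R := ℂ) x • cotrElement A := by
  refine ext_dual fun f => ?_
  have key : evalLeft (mulRightDual f x) = ∑ j ∈ (ℛ ℂ x).index,
      LinearMap.mulRight ℂ (antipode ℂ ((ℛ ℂ x).right j)) ∘ₗ
        (evalLeft f ∘ₗ LinearMap.mulRight ℂ ((ℛ ℂ x).left j)) := by
    ext y
    have h := congr((familyMulRight (evalLeftLin ∘ₗ mulRightDual f) y ∘ₗ
      (TensorProduct.comm ℂ A A).toLinearMap)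
      $(sum_tmul_cancel cancels_mulAntipode x))
    simp only [map_sum, familyMulRight_tmul, LinearMap.comp_apply, mulAntipode_apply,
      LinearEquiv.coe_coe, TensorProduct.comm_tmul, mul_one] at h
    refine h.symm.trans ?_
    rw [LinearMap.sum_apply]
    refine Finset.sum_congr rfl fun j _ => ?_
    simp only [LinearMap.comp_apply, LinearMap.mulRight_apply]
    rw [evalLeft_mul (ℛ ℂ ((ℛ ℂ x).left j)), Finset.sum_mul]
    refine Finset.sum_congr rfl fun k _ => ?_
    rw [← mul_assoc]
    rfl
  have key2 : ∑ j ∈ (ℛ ℂ x).index, (evalLeft f ∘ₗ LinearMap.mulRight ℂ ((ℛ ℂ x).left j)) ∘ₗ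
      LinearMap.mulRight ℂ (antipode ℂ ((ℛ ℂ x).right j)) = counit (R := ℂ) x • evalLeft f := by
    ext y
    have := congr(evalLeft f (y * $((cancels_antipodeMul_flip hA).sum_eq x)))
    simpa [Finset.mul_sum, mul_assoc] using this
  change mulRightDual f x (cotrElement A) = _
  rw [apply_cotrElement, key, sum_trace_comp_comm, key2, map_smul, map_smul, apply_cotrElement]

lemma counit_cotrElement [Module.Finite ℂ A] :
    counit (R := ℂ) (cotrElement A) = Module.finrank ℂ A := by
  rw [apply_cotrElement, evalLeft_counit, LinearMap.trace_id]

lemma trace_rank_one (f : A →ₗ[ℂ] ℂ) (v : A) [Module.Finite ℂ A] :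
    LinearMap.trace ℂ A (f.smulRight v) = f v := by
  simp

/-- Left multiplication by `ℓ` is the rank one map `x ↦ ε(x) ℓ`, whose trace is `ε(ℓ)`. -/
lemma tr_cotrElement [Module.Finite ℂ A] (hA : IsInvolutory A) :
    tr A (cotrElement A) = Module.finrank ℂ A := by
  rw [tr_apply, ← counit_cotrElement, ← trace_rank_one]
  congr 1
  ext x
  simp [cotrElement_mul hA]

lemma tr_antipode_cotrElement [Module.Finite ℂ A] (hA : IsInvolutory A) :
    tr A (antipode ℂ (cotrElement A)) = Module.finrank ℂ A := by
  rw [tr_apply, ← counit_cotrElement, ← counit_antipode, ← trace_rank_one]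
  congr 1
  ext x
  have := congr(antipode ℂ $(mul_cotrElement hA (antipode ℂ x)))
  simpa [antipode_mul_antidistrib, hA _] using this

lemma tr_one [Module.Finite ℂ A] : tr A 1 = Module.finrank ℂ A := by
  rw [tr_apply, LinearMap.mulLeft_one, LinearMap.trace_id]

lemma finrank_ne_zero [Module.Finite ℂ A] : (Module.finrank ℂ A : ℂ) ≠ 0 := by
  have : Nontrivial A := by
    refine nontrivial_of_ne 1 0 fun h => ?_
    have := congr(counit (R := ℂ) $h)
    simp at this
  exact_mod_cast Module.finrank_pos.ne'

/-- The product `ℓ l` equals `n l` because `l` is a left co-integral, and `ε(l) ℓ` because `ℓ` is a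
right one. -/
lemma IsCointegral.eq_smul [Module.Finite ℂ A] (hA : IsInvolutory A) {l : A}
    (hl : IsCointegral l) :
    l = (counit (R := ℂ) l / (Module.finrank ℂ A : ℂ)) • cotrElement A := by
  have h1 := hl (cotrElement A)
  rw [cotrElement_mul hA, counit_cotrElement] at h1
  rw [div_eq_inv_mul, mul_smul, h1, inv_smul_smul₀ finrank_ne_zero]

lemma IsCointegral.eq_cotrElement [Module.Finite ℂ A] (hA : IsInvolutory A) {l : A}
    (hl : IsCointegral l) (htr : tr A l = Module.finrank ℂ A) : l = cotrElement A := by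
  have h1 := hl.eq_smul hA
  have h2 := congr(tr A $h1)
  rw [map_smul, tr_cotrElement hA, htr, smul_eq_mul,
    div_mul_cancel₀ _ finrank_ne_zero] at h2
  rw [h1, ← h2, div_self finrank_ne_zero, one_smul]

lemma IsIntegralFunctional.eq_smul [Module.Finite ℂ A] (hA : IsInvolutory A) {Λ : DualAlg A}
    (hΛ : IsIntegralFunctional Λ) :
    Λ = (Λ 1 / (Module.finrank ℂ A : ℂ)) • toConv (tr A) := by
  have h1 := hΛ (toConv (tr A))
  rw [conv_mul_tr hA, show toConv (tr A) 1 = _ from tr_one] at h1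
  rw [div_eq_inv_mul, mul_smul, h1, inv_smul_smul₀ finrank_ne_zero]

lemma IsIntegralFunctional.eq_tr [Module.Finite ℂ A] (hA : IsInvolutory A) {Λ : DualAlg A}
    (hΛ : IsIntegralFunctional Λ) (h : cotr A Λ = Module.finrank ℂ A) : Λ = toConv (tr A) := by
  have h1 := hΛ.eq_smul hA
  have h2 := congr(cotr A $h1)
  rw [map_smul, cotr_eq (toConv (tr A)), show toConv (tr A) _ = _ from tr_cotrElement hA, h,
    smul_eq_mul, div_mul_cancel₀ _ finrank_ne_zero] at h2
  rw [h1, ← h2, div_self finrank_ne_zero, one_smul]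

/-- Reversing the coproduct, `S` exchanges left and right integrals: this is `conv_mul_tr` evaluated
at `S(x)`. -/
lemma tr_antipode_conv_mul [Module.Finite ℂ A] (hA : IsInvolutory A) (f : DualAlg A) :
    toConv (tr A ∘ₗ antipode ℂ) * f = f 1 • toConv (tr A ∘ₗ antipode ℂ) := by
  ext x
  have h := congr($(conv_mul_tr hA (toConv (f.ofConv ∘ₗ antipode ℂ))) (antipode ℂ x))
  rw [LinearMap.convMul_apply, comul_antipode] at h
  rw [(ℛ ℂ x).convMul_apply]
  simpa [hA _, mul_comm] using h

/-- The contraction of the two weights of a link of the lattice. -/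
lemma sum_tr_antipode_mul [Module.Finite ℂ A] (hA : IsInvolutory A) (y : A) (f : DualAlg A) :
    ∑ j ∈ (ℛ ℂ (cotrElement A)).index,
      tr A (y * antipode ℂ ((ℛ ℂ (cotrElement A)).left j)) * f ((ℛ ℂ (cotrElement A)).right j) =
      Module.finrank ℂ A * f y := by
  set l := cotrElement A with hl
  -- the Frobenius property of the co-integral
  have frob : ∀ y : A, ∑ j ∈ (ℛ ℂ l).index, (ℛ ℂ l).left j ⊗ₜ[ℂ] (y * (ℛ ℂ l).right j) =
      ∑ j ∈ (ℛ ℂ l).index, (antipode ℂ y * (ℛ ℂ l).left j) ⊗ₜ[ℂ] (ℛ ℂ l).right j := by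
    intro y
    -- Multiply `S(y₁) y₂ ⊗ y₃ = 1 ⊗ y` by `Δ(ℓ)`: on the left, `Δ(y₂) Δ(ℓ) = Δ(y₂ ℓ)` collapses to
    -- `ε(y₂) Δ(ℓ)`.
    have h := congr($(sum_cancel_tmul cancels_antipodeMul y) * comul (R := ℂ) l)
    have h2 : ∀ z : A, comul (R := ℂ) (z * l) = counit (R := ℂ) z • comul (R := ℂ) l := fun z => by
      rw [mul_cotrElement hA, map_smul]
    have h3 : ∀ u v : A, ∑ j ∈ (ℛ ℂ v).index,
        antipodeMul u ((ℛ ℂ v).left j) ⊗ₜ[ℂ] (ℛ ℂ v).right j =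
        (antipode ℂ u ⊗ₜ[ℂ] 1) * comul (R := ℂ) v := fun u v => by
      rw [← (ℛ ℂ v).eq, Finset.mul_sum]
      simp
    simp only [h3, Finset.sum_mul, mul_assoc, ← Bialgebra.comul_mul, h2, mul_smul_comm] at h
    simp only [← smul_mul_assoc, ← Finset.sum_mul, TensorProduct.smul_tmul', ← map_smul,
      ← TensorProduct.sum_tmul, ← map_sum] at h
    have h4 := sum_counit_smul (ℛ ℂ y)
    have h5 : ∑ i ∈ (ℛ ℂ y).index,
      counit (R := ℂ) ((ℛ ℂ y).right i) • (ℛ ℂ y).left i = y := by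
      have := congr(TensorProduct.rid ℂ A $(sum_tmul_counit_eq (ℛ ℂ y)))
      simpa only [map_sum, TensorProduct.rid_tmul, one_smul] using this
    rw [h5, ← (ℛ ℂ l).eq, Finset.mul_sum, Finset.mul_sum] at h
    simpa using h.symm
  -- The integral property gives `∑ tr(S(ℓ₁)) f(y ℓ₂) = f(y) tr(S(ℓ))`; the Frobenius property then
  -- moves `y` into the trace.
  have h := congr($(tr_antipode_conv_mul hA (toConv (mulLeftDual f.ofConv y))) l)
  rw [(ℛ ℂ l).convMul_apply] at h
  have h2 := congr(TensorProduct.lift ((LinearMap.mul ℂ ℂ).compl₁₂ (tr A ∘ₗ antipode ℂ) f.ofConv)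
    $(frob y))
  simp [antipode_mul_antidistrib, hA _] at h h2
  rw [h2] at h
  simp only [tr_mul_comm y, h]
  rw [tr_antipode_cotrElement hA, mul_comm]

end Trace

/-! ### Star and plaquette legs on a single link -/

section Sites

variable {A : Type*} [Ring A] [HopfAlgebra ℂ A]

/-- Cyclicity of `tr` gathers the face weight into `tr(y S(bᵤ))` with `y = S(c') x c`, the image of
`x` under both star legs. The red weight is a product evaluated at `ℓ`, so `sum_tr_antipode_mul`
applies and the outer two factors `β`, `α` become the plaquette legs. -/
lemma sum_link_weights [Module.Finite ℂ A] (hA : IsInvolutory A) {ι : Type*} [Fintype ι]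
    (b : Module.Basis ι ℂ A) (x c c' : A) (α β γ : DualAlg A) :
    ∑ u, blueWeight 1 [x, c, crossing false (b u), crossing false c'] *
      redWeight 1 [dualVec b u, β, γ, α] =
      Module.finrank ℂ A *
        γ (evalRight α.ofConv (evalLeft β.ofConv (antipode ℂ c' * (x * c)))) := by
  have h := sum_tr_antipode_mul hA (antipode ℂ c' * (x * c)) (β * (γ * α))
  have h1 : ∀ z : A, blueWeight 1 [x, c, crossing false z, crossing false c'] =
      tr A (antipode ℂ c' * (x * c) * antipode ℂ z) := fun z => by
    simp only [blueWeight, crossing, List.prod_cons, List.prod_nil, mul_one, one_mul]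
    rw [← mul_assoc, ← mul_assoc, tr_mul_comm]
    simp [mul_assoc]
  rw [← dual_mul_apply_evalRight, ← dual_mul_apply_evalLeft, ← h]
  simp only [h1, redWeight, List.prod_cons, List.prod_nil, mul_one, one_mul, cotr_eq,
    (ℛ ℂ (cotrElement A)).convMul_apply (dualVec b _), Finset.mul_sum]
  rw [Finset.sum_comm]
  refine Finset.sum_congr rfl fun j _ => ?_
  have h2 := sum_coord_smul b (tr A ∘ₗ LinearMap.mulLeft ℂ (antipode ℂ c' * (x * c)) ∘ₗ antipode ℂ)
    ((ℛ ℂ (cotrElement A)).left j)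
  simp only [LinearMap.comp_apply, LinearMap.mulLeft_apply] at h2
  rw [← h2, Finset.sum_mul]
  refine Finset.sum_congr rfl fun i _ => ?_
  rw [smul_eq_mul]
  change _ * (b.coord i _ * _) = _
  ring

/-- The action on the algebra of a link of the leg of a plaquette operator. -/
def plaquetteSite (d : Bool) : (A →ₗ[ℂ] ℂ) →ₗ[ℂ] (A →ₗ[ℂ] A) :=
  if d then evalRightLin else evalLeftLin ∘ₗ LinearMap.lcomp ℂ ℂ (antipode ℂ)

/-- The action on the algebra of a link of the leg of a star operator. -/
def starSite (d : Bool) : A →ₗ[ℂ] (A →ₗ[ℂ] A) :=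
  if d then LinearMap.mul ℂ A ∘ₗ antipode ℂ else (LinearMap.mul ℂ A).flip

lemma plaquetteSite_true (f : A →ₗ[ℂ] ℂ) : plaquetteSite true f = evalRight f := rfl
lemma plaquetteSite_false (f : A →ₗ[ℂ] ℂ) :
    plaquetteSite false f = evalLeft (f ∘ₗ antipode ℂ) := rfl
lemma starSite_true (h : A) : starSite true h = LinearMap.mulLeft ℂ (antipode ℂ h) := rfl
lemma starSite_false (h : A) : starSite false h = LinearMap.mulRight ℂ h := rfl

/-- The coproduct of `S x`. -/
def antipodeRepr (x : A) : Repr ℂ (antipode ℂ x) (A × A) where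
  left i := antipode ℂ ((ℛ ℂ x).right i)
  right i := antipode ℂ ((ℛ ℂ x).left i)
  index := (ℛ ℂ x).index
  eq := (comul_antipode x).symm

/-- Behind the star leg, the letter sent to the plaquette word begins with `S(h₂)`; the factor `h₁`
placed before it cancels it. -/
lemma sum_plaquetteSite_comp_starSite (d : Bool) (f : A →ₗ[ℂ] ℂ) (h : A) :
    ∑ j ∈ (ℛ ℂ h).index, plaquetteSite d (mulLeftDual f ((ℛ ℂ h).left j)) ∘ₗ
      starSite d ((ℛ ℂ h).right j) = starSite d h ∘ₗ plaquetteSite d f := by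
  ext x
  rw [LinearMap.sum_apply]
  cases d
  · have key := congr((familyMulRight (plaquetteSite false ∘ₗ mulLeftDual f) x ∘ₗ
      (TensorProduct.comm ℂ A A).toLinearMap) $(sum_cancel_tmul cancels_mulAntipode h))
    simp only [map_sum, familyMulRight_tmul, LinearMap.comp_apply, mulAntipode_apply,
      LinearEquiv.coe_coe, TensorProduct.comm_tmul, mulLeftDual_one] at key
    refine Eq.trans ?_ key
    refine Finset.sum_congr rfl fun j _ => ?_
    simp only [LinearMap.comp_apply, plaquetteSite_false, starSite_false, LinearMap.mulRight_apply]
    rw [evalLeft_mul (ℛ ℂ ((ℛ ℂ h).right j))]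
    refine Finset.sum_congr rfl fun k _ => ?_
    congr 3
    ext y
    simp [antipode_mul_antidistrib, mul_assoc]
  · have key := congr((familyMulLeft (plaquetteSite true ∘ₗ mulLeftDual f) x ∘ₗ
      TensorProduct.map (antipode ℂ) LinearMap.id ∘ₗ
      (TensorProduct.comm ℂ A A).toLinearMap) $(sum_cancel_tmul cancels_mulAntipode h))
    simp only [map_sum, familyMulLeft_tmul, LinearMap.comp_apply, mulAntipode_apply,
      LinearEquiv.coe_coe, TensorProduct.comm_tmul, mulLeftDual_one, TensorProduct.map_tmul,
      LinearMap.id_apply] at key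
    refine Eq.trans ?_ key
    refine Finset.sum_congr rfl fun j _ => ?_
    simp only [LinearMap.comp_apply, plaquetteSite_true, starSite_true, LinearMap.mulLeft_apply]
    rw [evalRight_mul' (antipodeRepr ((ℛ ℂ h).right j))]
    refine Finset.sum_congr rfl fun k _ => ?_
    rw [mulLeftDual_mul]
    rfl

/-- On the other side of the link the star leg leaves an uncancelled `h₂` at the end of the letter,
available to the next letter of the plaquette word. -/
lemma plaquetteSite_not_comp_starSite (hA : IsInvolutory A) (d : Bool) (f : A →ₗ[ℂ] ℂ) (h : A) :
    plaquetteSite (!d) f ∘ₗ starSite d h = ∑ j ∈ (ℛ ℂ h).index,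
      starSite d ((ℛ ℂ h).left j) ∘ₗ plaquetteSite (!d) (mulRightDual f ((ℛ ℂ h).right j)) := by
  ext x
  rw [LinearMap.sum_apply]
  cases d
  · exact evalRight_mul (ℛ ℂ h) f
  · refine (evalLeft_mul' (antipodeRepr h) (f ∘ₗ antipode ℂ)).trans ?_
    refine Finset.sum_congr rfl fun j _ => ?_
    simp only [LinearMap.comp_apply, Bool.not_true, plaquetteSite_false, starSite_true,
      LinearMap.mulLeft_apply]
    change antipode ℂ _ * _ = _
    congr 3
    ext y
    simp [antipodeRepr, antipode_mul_antidistrib, hA _]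

lemma plaquetteSite_comm {d d' : Bool} (h : d ≠ d') (f g : A →ₗ[ℂ] ℂ) :
    plaquetteSite d f ∘ₗ plaquetteSite d' g = plaquetteSite d' g ∘ₗ plaquetteSite d f := by
  cases d <;> cases d' <;> first | exact absurd rfl h | skip
  · exact (evalRight_evalLeft_comm _ _).symm
  · exact evalRight_evalLeft_comm _ _

lemma starSite_comm {d d' : Bool} (h : d ≠ d') (x y : A) :
    starSite d x ∘ₗ starSite d' y = starSite d' y ∘ₗ starSite d x := by
  cases d <;> cases d' <;> first | exact absurd rfl h | skip
  all_goals
    ext z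
    simp [starSite_true, starSite_false, mul_assoc]

lemma antipode_dual_conv (f g : DualAlg A) : (f * g).ofConv ∘ₗ antipode ℂ =
    (toConv (g.ofConv ∘ₗ antipode ℂ) * toConv (f.ofConv ∘ₗ antipode ℂ)).ofConv := by
  ext x
  change (f * g) (antipode ℂ x) = (_ * _ : DualAlg A) x
  rw [(antipodeRepr x).convMul_apply, (ℛ ℂ x).convMul_apply]
  simp [antipodeRepr, mul_comm]

lemma plaquetteSite_comp_plaquetteSite (d : Bool) (f g : DualAlg A) :
    plaquetteSite d f.ofConv ∘ₗ plaquetteSite d g.ofConv = plaquetteSite d (f * g).ofConv := by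
  cases d
  · rw [plaquetteSite_false, plaquetteSite_false, plaquetteSite_false, antipode_dual_conv]
    exact evalLeft_comp_evalLeft (toConv (f.ofConv ∘ₗ antipode ℂ)) (toConv (g.ofConv ∘ₗ antipode ℂ))
  · exact evalRight_comp_evalRight f g

lemma starSite_comp_starSite (d : Bool) (x y : A) :
    starSite d x ∘ₗ starSite d y = starSite d (y * x) := by
  cases d <;> ext z <;> simp [starSite_true, starSite_false, mul_assoc, antipode_mul_antidistrib]

lemma plaquetteSite_counit (d : Bool) :
    plaquetteSite (A := A) d (counit (R := ℂ)) = LinearMap.id := by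
  cases d
  · rw [plaquetteSite_false, counit_comp_antipode, evalLeft_counit]
  · exact evalRight_counit

lemma starSite_one (d : Bool) : starSite (A := A) d 1 = LinearMap.id := by
  cases d <;> ext z <;> simp [starSite_true, starSite_false]

end Sites

/-! ### Operators on the tensor product over all links -/

section SiteTensors

variable {ι : Type*} [Fintype ι] [DecidableEq ι] {E : Type*} [Fintype E] [DecidableEq E]

/-- The tensor product over the links of a family of matrices. -/
def siteTensor (G : E → Matrix ι ι ℂ) : Matrix (E → ι) (E → ι) ℂ :=
  Matrix.of fun i j => ∏ e, G e (i e) (j e)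

lemma siteTensor_mul (G G' : E → Matrix ι ι ℂ) :
    siteTensor (G * G') = siteTensor G * siteTensor G' := by
  ext i j
  simp only [siteTensor, Matrix.of_apply, Matrix.mul_apply, Pi.mul_apply]
  rw [Finset.prod_univ_sum, Fintype.piFinset_univ]
  simp [Finset.prod_mul_distrib]

lemma siteTensor_one : siteTensor (1 : E → Matrix ι ι ℂ) = 1 := by
  ext i j
  simp only [siteTensor, Matrix.of_apply, Pi.one_apply, Matrix.one_apply]
  rw [Finset.prod_ite_zero]
  simp [funext_iff]

/-- `siteTensor` as a morphism of monoids. -/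
def siteTensorHom : (E → Matrix ι ι ℂ) →* Matrix (E → ι) (E → ι) ℂ where
  toFun := siteTensor
  map_one' := siteTensor_one
  map_mul' := siteTensor_mul

variable {A : Type*} [Ring A] [HopfAlgebra ℂ A] (b : Module.Basis ι ℂ A)

lemma siteOp_eq_siteTensor (e : E) (g : A →ₗ[ℂ] A) :
    siteOp b e g = siteTensorHom (Pi.mulSingle e (LinearMap.toMatrix b b g)) := by
  ext i j
  simp only [siteOp, siteTensorHom, MonoidHom.coe_mk, OneHom.coe_mk, siteTensor, Matrix.of_apply]
  rw [← Finset.mul_prod_erase _ _ (Finset.mem_univ e), Pi.mulSingle_eq_same]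
  congr 1
  refine Finset.prod_congr rfl fun e' he' => ?_
  rw [Pi.mulSingle_eq_of_ne (Finset.ne_of_mem_erase he')]

lemma siteOp_comp (e : E) (g g' : A →ₗ[ℂ] A) :
    siteOp b e (g ∘ₗ g') = siteOp b e g * siteOp b e g' := by
  rw [siteOp_eq_siteTensor, siteOp_eq_siteTensor, siteOp_eq_siteTensor, ← map_mul,
    ← Pi.mulSingle_mul, LinearMap.toMatrix_comp b b b]

lemma siteOp_id (e : E) : siteOp b e LinearMap.id = 1 := by
  rw [siteOp_eq_siteTensor, LinearMap.toMatrix_id, Pi.mulSingle_one, map_one]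

lemma siteOp_commute {e e' : E} (h : e ≠ e') (g g' : A →ₗ[ℂ] A) :
    Commute (siteOp b e g) (siteOp b e' g') := by
  rw [siteOp_eq_siteTensor, siteOp_eq_siteTensor]
  exact (Pi.mulSingle_commute h _ _).map siteTensorHom

/-- `siteOp` as a linear map. -/
def siteOpLin (e : E) : (A →ₗ[ℂ] A) →ₗ[ℂ] Matrix (E → ι) (E → ι) ℂ where
  toFun := siteOp b e
  map_add' g g' := by ext i j; simp [siteOp, add_mul]
  map_smul' c g := by ext i j; simp [siteOp, mul_assoc]

@[simp] lemma siteOpLin_apply (e : E) (g : A →ₗ[ℂ] A) : siteOpLin b e g = siteOp b e g := rfl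

/-- The legs of the plaquette operators as linear maps. -/
def plaquetteLegLin (d : Dart E) : (A →ₗ[ℂ] ℂ) →ₗ[ℂ] Matrix (E → ι) (E → ι) ℂ :=
  siteOpLin b d.1 ∘ₗ plaquetteSite d.2

/-- The legs of the star operators as linear maps. -/
def starLegLin (d : Dart E) : A →ₗ[ℂ] Matrix (E → ι) (E → ι) ℂ :=
  siteOpLin b d.1 ∘ₗ starSite d.2

lemma plaquetteLegLin_apply (d : Dart E) (f : A →ₗ[ℂ] ℂ) :
    plaquetteLegLin b d f = siteOp b d.1 (plaquetteSite d.2 f) := rfl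

lemma starLegLin_apply (d : Dart E) (h : A) :
    starLegLin b d h = siteOp b d.1 (starSite d.2 h) := rfl

lemma plaquetteLeg_eq (d : Dart E) (f : A →ₗ[ℂ] ℂ) :
    plaquetteLeg b d f = plaquetteLegLin b d f := by
  obtain ⟨e, _ | _⟩ := d <;> rfl

lemma starLeg_eq (d : Dart E) (h : A) : starLeg b d h = starLegLin b d h := by
  obtain ⟨e, _ | _⟩ := d <;> rfl

/-- Distinct darts on one link use opposite sides of the coproduct, which commute by
coassociativity. -/
lemma plaquetteLegLin_commute {d d' : Dart E} (h : d ≠ d') (f g : A →ₗ[ℂ] ℂ) :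
    Commute (plaquetteLegLin b d f) (plaquetteLegLin b d' g) := by
  obtain ⟨e, s⟩ := d
  obtain ⟨e', s'⟩ := d'
  by_cases he : e = e'
  · subst he
    have hs : s ≠ s' := fun hs => h (by rw [hs])
    simp only [plaquetteLegLin_apply, Commute, SemiconjBy, ← siteOp_comp, plaquetteSite_comm hs]
  · exact siteOp_commute b he _ _

lemma starLegLin_commute {d d' : Dart E} (h : d ≠ d') (x y : A) :
    Commute (starLegLin b d x) (starLegLin b d' y) := by
  obtain ⟨e, s⟩ := d
  obtain ⟨e', s'⟩ := d'
  by_cases he : e = e'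
  · subst he
    have hs : s ≠ s' := fun hs => h (by rw [hs])
    simp only [starLegLin_apply, Commute, SemiconjBy, ← siteOp_comp, starSite_comm hs]
  · exact siteOp_commute b he _ _

lemma plaquetteLegLin_starLegLin_commute {d d' : Dart E} (h : d.1 ≠ d'.1) (f : A →ₗ[ℂ] ℂ) (x : A) :
    Commute (plaquetteLegLin b d f) (starLegLin b d' x) :=
  siteOp_commute b h _ _

lemma plaquetteLegLin_mul (d : Dart E) (f g : DualAlg A) :
    plaquetteLegLin b d f.ofConv * plaquetteLegLin b d g.ofConv =
      plaquetteLegLin b d (f * g).ofConv := by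
  simp only [plaquetteLegLin_apply, ← siteOp_comp, plaquetteSite_comp_plaquetteSite]

lemma starLegLin_mul (d : Dart E) (x y : A) :
    starLegLin b d x * starLegLin b d y = starLegLin b d (y * x) := by
  simp only [starLegLin_apply, ← siteOp_comp, starSite_comp_starSite]

lemma plaquetteLegLin_counit (d : Dart E) : plaquetteLegLin b d (counit (R := ℂ)) = 1 := by
  rw [plaquetteLegLin_apply, plaquetteSite_counit, siteOp_id]

lemma starLegLin_one (d : Dart E) : starLegLin b d 1 = 1 := by
  rw [starLegLin_apply, starSite_one, siteOp_id]

lemma sum_plaquetteLegLin_mul_starLegLin (d : Dart E) (f : A →ₗ[ℂ] ℂ) (h : A) :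
    ∑ j ∈ (ℛ ℂ h).index, plaquetteLegLin b d (mulLeftDual f ((ℛ ℂ h).left j)) *
      starLegLin b d ((ℛ ℂ h).right j) = starLegLin b d h * plaquetteLegLin b d f := by
  have := congr(siteOpLin b d.1 $(sum_plaquetteSite_comp_starSite d.2 f h))
  simpa only [map_sum, siteOpLin_apply, siteOp_comp, plaquetteLegLin_apply, starLegLin_apply]
    using this

lemma plaquetteLegLin_flip_mul_starLegLin (hA : IsInvolutory A) (d : Dart E) (f : A →ₗ[ℂ] ℂ)
    (h : A) :
    plaquetteLegLin b (flipDart E d) f * starLegLin b d h = ∑ j ∈ (ℛ ℂ h).index,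
      starLegLin b d ((ℛ ℂ h).left j) *
        plaquetteLegLin b (flipDart E d) (mulRightDual f ((ℛ ℂ h).right j)) := by
  have := congr(siteOpLin b d.1 $(plaquetteSite_not_comp_starSite hA d.2 f h))
  simp only [map_sum, siteOpLin_apply, siteOp_comp] at this
  exact this

end SiteTensors

/-! ### Tensor contractions as products in `A ⊗ M` and in the convolution algebra -/

section Contraction

variable {ι : Type*} [Fintype ι] {D : Type*}

lemma prod_map_sum {M : Type*} [Ring M] [Algebra ℂ M] (ds : List D) (F : D → ι → M) :
    (ds.map fun d => ∑ i, F d i).prod =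
      ∑ l : Fin ds.length → ι, (List.ofFn fun k => F (ds.get k) (l k)).prod := by
  classical
  have h := (MultilinearMap.mkPiAlgebraFin ℂ ds.length M).map_sum
    (fun k i => F (ds.get k) i)
  simp only [MultilinearMap.mkPiAlgebraFin_apply] at h
  rw [← h]
  congr 1
  conv_lhs => rw [← List.ofFn_get ds, List.map_ofFn]
  rfl

variable {A : Type*} [Ring A] [HopfAlgebra ℂ A] {M : Type*} [Ring M] [Algebra ℂ M]

/-- `a ⊗ m ↦ f(a) m`. -/
def contract (f : A →ₗ[ℂ] ℂ) : A ⊗[ℂ] M →ₗ[ℂ] M :=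
  (TensorProduct.lid ℂ M).toLinearMap ∘ₗ LinearMap.rTensor M f

@[simp] lemma contract_tmul (f : A →ₗ[ℂ] ℂ) (a : A) (m : M) :
    contract f (a ⊗ₜ[ℂ] m) = f a • m := by
  simp [contract]

lemma contract_left_mul (f : A →ₗ[ℂ] ℂ) (a : A) (X : A ⊗[ℂ] M) :
    contract f ((a ⊗ₜ 1) * X) = contract (mulLeftDual f a) X := by
  induction X with
  | zero => simp
  | add X Y hX hY => rw [mul_add, map_add, hX, hY, map_add]
  | tmul x m => simp

lemma contract_mul_left (f : A →ₗ[ℂ] ℂ) (a : A) (X : A ⊗[ℂ] M) :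
    contract f (X * (a ⊗ₜ 1)) = contract (mulRightDual f a) X := by
  induction X with
  | zero => simp
  | add X Y hX hY => rw [add_mul, map_add, hX, hY, map_add]
  | tmul x m => simp

lemma contract_right_mul (f : A →ₗ[ℂ] ℂ) (m : M) (X : A ⊗[ℂ] M) :
    contract f ((1 ⊗ₜ m) * X) = m * contract f X := by
  induction X with
  | zero => simp
  | add X Y hX hY => rw [mul_add, map_add, hX, hY, map_add, mul_add]
  | tmul x m => simp

lemma contract_mul_right (f : A →ₗ[ℂ] ℂ) (m : M) (X : A ⊗[ℂ] M) :
    contract f (X * (1 ⊗ₜ m)) = contract f X * m := by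
  induction X with
  | zero => simp
  | add X Y hX hY => rw [add_mul, map_add, hX, hY, map_add, add_mul]
  | tmul x m => simp

lemma contract_tmul_mul (f : A →ₗ[ℂ] ℂ) (a : A) (m : M) (X : A ⊗[ℂ] M) :
    contract f ((a ⊗ₜ m) * X) = m * contract (mulLeftDual f a) X := by
  rw [← contract_left_mul, ← contract_right_mul, ← mul_assoc]
  simp

variable (b : Module.Basis ι ℂ A)

lemma sum_tmul_contract (X : A ⊗[ℂ] M) : ∑ i, b i ⊗ₜ[ℂ] contract (b.coord i) X = X := by
  induction X with
  | zero => simp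
  | add X Y hX hY => simp [TensorProduct.tmul_add, Finset.sum_add_distrib, hX, hY]
  | tmul x m =>
    simp only [contract_tmul, ← TensorProduct.smul_tmul, ← TensorProduct.sum_tmul]
    simp [b.sum_repr]

lemma contract_ext (b : Module.Basis ι ℂ A) {X Y : A ⊗[ℂ] M} (h : ∀ f : A →ₗ[ℂ] ℂ, contract f X = contract f Y) :
    X = Y := by
  rw [← sum_tmul_contract b X, ← sum_tmul_contract b Y]
  simp only [h]

/-- The element of `A ⊗ M` representing the linear map `r : A* → M`. -/
def dualElement (r : (A →ₗ[ℂ] ℂ) →ₗ[ℂ] M) : A ⊗[ℂ] M := ∑ i, b i ⊗ₜ r (b.coord i)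

@[simp] lemma contract_dualElement (r : (A →ₗ[ℂ] ℂ) →ₗ[ℂ] M) (f : A →ₗ[ℂ] ℂ) :
    contract f (dualElement b r) = r f := by
  have h := congr(r $(b.sum_dual_apply_smul_coord f))
  rw [map_sum] at h
  rw [dualElement, map_sum, ← h]
  exact Finset.sum_congr rfl fun i _ => by rw [contract_tmul, map_smul]

lemma contract_mul (f : A →ₗ[ℂ] ℂ) (X Y : A ⊗[ℂ] M) :
    contract f (X * Y) =
      ∑ i, ∑ j, f (b i * b j) • (contract (b.coord i) X * contract (b.coord j) Y) := by
  conv_lhs => rw [← sum_tmul_contract b X, ← sum_tmul_contract b Y]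
  simp [Finset.sum_mul_sum]

/-- In a basis, traciality of `f` swaps the `A` factors and commutation of the coefficients swaps
the `M` factors. This makes a plaquette operator independent of the starting dart. -/
lemma contract_mul_comm (b : Module.Basis ι ℂ A) {f : A →ₗ[ℂ] ℂ}
    (hf : ∀ x y, f (x * y) = f (y * x)) {X Y : A ⊗[ℂ] M}
    (h : ∀ f g : A →ₗ[ℂ] ℂ, Commute (contract f X) (contract g Y)) :
    contract f (X * Y) = contract f (Y * X) := by
  rw [contract_mul b, contract_mul b, Finset.sum_comm]
  refine Finset.sum_congr rfl fun i _ => Finset.sum_congr rfl fun j _ => ?_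
  rw [hf, (h _ _).eq]

lemma prod_map_tmul {R : Type*} [Ring R] [Algebra ℂ R] {κ : Type*} (l : List κ) (x : κ → R)
    (m : κ → M) :
    (l.map fun k => x k ⊗ₜ[ℂ] m k).prod = (l.map x).prod ⊗ₜ (l.map m).prod := by
  induction l with
  | nil => simp [Algebra.TensorProduct.one_def]
  | cons k l ih => simp [ih]

/-- The contraction of a product of elements of `A ⊗ M`. -/
lemma contract_prod (ds : List D) (x : D → ι → A) (m : D → ι → M) (f : A →ₗ[ℂ] ℂ) :
    contract f (ds.map fun d => ∑ i, x d i ⊗ₜ[ℂ] m d i).prod =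
      ∑ l : Fin ds.length → ι, f (List.ofFn fun k => x (ds.get k) (l k)).prod •
        (List.ofFn fun k => m (ds.get k) (l k)).prod := by
  rw [prod_map_sum, map_sum]
  refine Finset.sum_congr rfl fun l _ => ?_
  simp only [List.ofFn_eq_map]
  rw [prod_map_tmul, contract_tmul]

/-- The rank one element `x ↦ f(x) m` of the convolution algebra. -/
def rankOne (f : DualAlg A) (m : M) : WithConv (A →ₗ[ℂ] M) := toConv (f.ofConv.smulRight m)

@[simp] lemma rankOne_apply (f : DualAlg A) (m : M) (x : A) : rankOne f m x = f x • m := rfl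

lemma rankOne_mul (f g : DualAlg A) (m m' : M) :
    rankOne f m * rankOne g m' = rankOne (f * g) (m * m') := by
  ext x
  change (rankOne f m * rankOne g m') x = (f * g) x • _
  rw [(ℛ ℂ x).convMul_apply, (ℛ ℂ x).convMul_apply, Finset.sum_smul]
  refine Finset.sum_congr rfl fun i _ => ?_
  simp [smul_smul, mul_comm]

lemma rankOne_one : rankOne (1 : DualAlg A) (1 : M) = 1 := by
  ext x
  change counit (R := ℂ) x • (1 : M) = algebraMap ℂ M (counit x)
  rw [Algebra.algebraMap_eq_smul_one]

lemma prod_map_rankOne {κ : Type*} (l : List κ) (f : κ → DualAlg A) (m : κ → M) :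
    (l.map fun k => rankOne (f k) (m k)).prod = rankOne (l.map f).prod (l.map m).prod := by
  induction l with
  | nil => simp [rankOne_one]
  | cons k l ih => simp [ih, rankOne_mul]

lemma sum_rankOne (s : A →ₗ[ℂ] M) : ∑ i, rankOne (dualVec b i) (s (b i)) = toConv s := by
  ext x
  rw [ofConv_sum, LinearMap.sum_apply]
  exact sum_coord_smul b s x

/-- A product of linear maps in the convolution algebra, expanded in a basis. -/
lemma conv_prod_apply (ds : List D) (s : D → A →ₗ[ℂ] M) (z : A) :
    (ds.map fun d => toConv (s d)).prod z =
      ∑ l : Fin ds.length → ι, (List.ofFn fun k => dualVec b (l k)).prod z •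
        (List.ofFn fun k => s (ds.get k) (b (l k))).prod := by
  simp only [← sum_rankOne b]
  rw [prod_map_sum, ofConv_sum, LinearMap.sum_apply]
  refine Finset.sum_congr rfl fun l _ => ?_
  simp only [List.ofFn_eq_map]
  rw [prod_map_rankOne, rankOne_apply]

end Contraction

/-! ### Cycles of a permutation as lists -/

section OrbitLists

variable {D : Type*} [Finite D] (π : Equiv.Perm D)

lemma mem_periodicPts_perm (d : D) : d ∈ Function.periodicPts π :=
  Function.mem_periodicPts.2 ⟨orderOf π, orderOf_pos π, by
    rw [Function.IsPeriodicPt, Function.IsFixedPt, ← Equiv.Perm.coe_pow, pow_orderOf_eq_one]; rfl⟩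

lemma orbitList_eq_iterate (d : D) :
    orbitList π d = (List.range (Function.minimalPeriod π d)).map fun k => π^[k] d := by
  simp [orbitList, Equiv.Perm.iterate_eq_pow]

lemma orbitList_nodup (d : D) : (orbitList π d).Nodup := by
  have h := Function.nodup_periodicOrbit (f := π) (x := d)
  rwa [Function.periodicOrbit, Cycle.nodup_coe_iff, ← orbitList_eq_iterate] at h

lemma mem_orbitList {d x : D} : x ∈ orbitList π d ↔ π.SameCycle d x := by
  have h := Function.mem_periodicOrbit_iff (f := π) (y := x) (mem_periodicPts_perm π d)
  rw [Function.periodicOrbit, Cycle.mem_coe_iff, ← orbitList_eq_iterate] at h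
  rw [h]
  constructor
  · rintro ⟨n, hn⟩
    exact ⟨n, by simpa [Equiv.Perm.iterate_eq_pow] using hn⟩
  · intro hs
    obtain ⟨n, _, hn⟩ := hs.exists_pow_eq'
    exact ⟨n, by simpa [Equiv.Perm.iterate_eq_pow] using hn⟩

lemma length_orbitList (d : D) : (orbitList π d).length = Function.minimalPeriod π d := by
  simp [orbitList]

lemma orbitList_eq_cons (d : D) : ∃ t, orbitList π d = d :: t := by
  have h := Function.minimalPeriod_pos_of_mem_periodicPts (mem_periodicPts_perm π d)
  obtain ⟨n, hn⟩ := Nat.exists_eq_succ_of_ne_zero h.ne'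
  refine ⟨(List.range n).map fun k => (π ^ (k + 1)) d, ?_⟩
  rw [orbitList, hn, List.range_succ_eq_map]
  simp [Function.comp_def]

lemma orbitList_isChain (d : D) : (orbitList π d).IsChain fun x y => π x = y := by
  rw [List.isChain_iff_getElem]
  intro i hi
  simp [orbitList, pow_succ']

lemma orbitList_eq_concat (d : D) : ∃ t, orbitList π d = t ++ [π⁻¹ d] := by
  have h := Function.minimalPeriod_pos_of_mem_periodicPts (mem_periodicPts_perm π d)
  obtain ⟨n, hn⟩ := Nat.exists_eq_succ_of_ne_zero h.ne'
  refine ⟨(List.range n).map fun k => (π ^ k) d, ?_⟩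
  rw [orbitList, hn, Nat.succ_eq_add_one, List.range_succ]
  have h2 := Function.iterate_minimalPeriod (f := π) (x := d)
  rw [hn, Equiv.Perm.iterate_eq_pow, Nat.succ_eq_add_one, pow_succ'] at h2
  simp only [List.map_append, List.map_cons, List.map_nil]
  congr 2
  rw [Equiv.Perm.eq_inv_iff_eq]
  exact h2

lemma orbitList_rotate {d x : D} (h : x ∈ orbitList π d) :
    ∃ s t, orbitList π d = s ++ t ∧ orbitList π x = t ++ s := by
  have hx := h
  simp only [orbitList, List.mem_map, List.mem_range] at h
  obtain ⟨k, hk, rfl⟩ := h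
  have hp : Function.minimalPeriod π ((π ^ k) d) = Function.minimalPeriod π d := by
    rw [← Equiv.Perm.iterate_eq_pow]
    exact Function.minimalPeriod_apply_iterate (mem_periodicPts_perm π d) k
  refine ⟨(orbitList π d).take k, (orbitList π d).drop k, (List.take_append_drop _ _).symm, ?_⟩
  rw [← List.rotate_eq_drop_append_take (by rw [length_orbitList]; exact hk.le)]
  refine List.ext_getElem (by simp [length_orbitList, hp]) fun i h1 h2 => ?_
  rw [List.getElem_rotate]
  simp only [orbitList, List.getElem_map, List.getElem_range, List.length_map, List.length_range]
  rw [← Equiv.Perm.iterate_eq_pow, ← Equiv.Perm.iterate_eq_pow π (_ % _),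
    Function.iterate_mod_minimalPeriod_eq, Function.iterate_add_apply,
    Equiv.Perm.iterate_eq_pow π k]

end OrbitLists

/-! ### Telescoping of letters inserted in a word -/

section Insertion

variable {A : Type*} [Ring A] [HopfAlgebra ℂ A] {N : Type*} [Ring N] [Algebra ℂ N]

/-- The constant element `h ↦ ε(h) X` of the convolution algebra. -/
def constConv (A : Type*) [Ring A] [HopfAlgebra ℂ A] {N : Type*} [Ring N] [Algebra ℂ N] :
    N →* WithConv (A →ₗ[ℂ] N) where
  toFun X := rankOne 1 X
  map_one' := rankOne_one
  map_mul' X Y := by rw [rankOne_mul, one_mul]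

lemma constConv_mul_apply (X : N) (f : WithConv (A →ₗ[ℂ] N)) (h : A) :
    (constConv A X * f) h = X * f h := by
  have h1 := congr(f $(sum_counit_smul (ℛ ℂ h)))
  rw [(ℛ ℂ h).convMul_apply, ← h1, map_sum, Finset.mul_sum]
  refine Finset.sum_congr rfl fun i _ => ?_
  change (counit (R := ℂ) _ • X) * _ = _
  rw [map_smul, smul_mul_assoc, mul_smul_comm]

lemma mul_constConv_apply (X : N) (f : WithConv (A →ₗ[ℂ] N)) (h : A) :
    (f * constConv A X) h = f h * X := by
  have h0 : ∑ i ∈ (ℛ ℂ h).index, counit (R := ℂ) ((ℛ ℂ h).right i) • (ℛ ℂ h).left i = h := by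
    have := congr(TensorProduct.rid ℂ A $(sum_tmul_counit_eq (ℛ ℂ h)))
    simpa only [map_sum, TensorProduct.rid_tmul, one_smul] using this
  have h1 := congr(f $h0)
  rw [(ℛ ℂ h).convMul_apply, ← h1, map_sum, Finset.sum_mul]
  refine Finset.sum_congr rfl fun i _ => ?_
  change _ * (counit (R := ℂ) _ • X) = _
  rw [map_smul, smul_mul_assoc, mul_smul_comm]

variable {C : Type*} [Ring C] {D : Type*} [DecidableEq D]

/-- The value at the dart `x` of the family `P`, with `g` inserted on the left if `x = d`. -/
def insertLeft (g : C) (P : D → C) (d x : D) : C := if x = d then g * P x else P x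

/-- The value at the dart `x` of the family `P`, with `g` inserted on the right if `x = d`. -/
def insertRight (g : C) (P : D → C) (d x : D) : C := if x = d then P x * g else P x

lemma prod_insertLeft_of_notMem (g : C) (P : D → C) {d : D} {ds : List D} (h : d ∉ ds) :
    (ds.map (insertLeft g P d)).prod = (ds.map P).prod := by
  congr 1
  refine List.map_congr_left fun x hx => ?_
  rw [insertLeft, if_neg]
  rintro rfl
  exact h hx

lemma prod_insertRight_of_notMem (g : C) (P : D → C) {d : D} {ds : List D} (h : d ∉ ds) :
    (ds.map (insertRight g P d)).prod = (ds.map P).prod := by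
  congr 1
  refine List.map_congr_left fun x hx => ?_
  rw [insertRight, if_neg]
  rintro rfl
  exact h hx

/-- After `x` and before its successor is the same place in the word; membership of `π x` in the
tail guarantees that `x` stands directly before it. -/
lemma prod_insertRight_eq_insertLeft (g : C) (P : D → C) (π : Equiv.Perm D) (x : D)
    (ds : List D) (hc : ds.IsChain fun x y => π x = y) (hn : ds.Nodup) (hx : π x ∈ ds.tail) :
    (ds.map (insertRight g P x)).prod = (ds.map (insertLeft g P (π x))).prod := by
  induction ds with
  | nil => simp at hx
  | cons y ds ih =>
    rw [List.tail_cons] at hx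
    rw [List.nodup_cons] at hn
    have hy : y ≠ π x := fun h => hn.1 (h ▸ hx)
    obtain _ | ⟨z, t⟩ := ds
    · simp at hx
    rw [List.isChain_cons_cons] at hc
    have hn2 := List.nodup_cons.1 hn.2
    by_cases hxy : y = x
    · subst hxy
      have hz : z = π y := hc.1.symm
      rw [List.map_cons, List.prod_cons, prod_insertRight_of_notMem g P hn.1, List.map_cons,
        List.prod_cons, List.map_cons, List.prod_cons, List.map_cons, List.prod_cons, ← hz,
        prod_insertLeft_of_notMem g P hn2.1]
      rw [insertLeft, if_neg (hz ▸ hy), insertLeft, if_pos rfl, insertRight, if_pos rfl]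
      simp only [mul_assoc]
    · have hz : z ≠ π x := fun h => hxy (π.injective (hc.1.trans h))
      have e := ih hc.2 hn.2 ((List.mem_cons.1 hx).resolve_left (Ne.symm hz))
      simp only [List.map_cons, List.prod_cons] at e ⊢
      rw [e]
      congr 1
      simp [insertRight, insertLeft, hy, hxy]

lemma prod_map_mul_eq {g : C} {P T : D → C} {τ : D → D}
    (h : ∀ d x, insertLeft g P d x * T d = T d * insertRight g P (τ d) x) (d : D) (ds : List D) :
    (ds.map (insertLeft g P d)).prod * T d = T d * (ds.map (insertRight g P (τ d))).prod := by
  induction ds with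
  | nil => simp
  | cons y ds ih =>
    rw [List.map_cons, List.prod_cons, List.map_cons, List.prod_cons, mul_assoc, ih, ← mul_assoc, h,
      mul_assoc]

/-- Passing `T d` through the word turns an insertion before `d` into one after `τ d`. As `π (τ d) =
σ d`, this is an insertion before the next dart of `vs`. The head of `ds` is excluded from `vs`
because the word is linear: nothing precedes its first letter. -/
lemma prod_insertLeft_mul_prod {g : C} {P T : D → C} {τ : D → D} {π σ : Equiv.Perm D}
    (hτ : ∀ d, π (τ d) = σ d)
    (h : ∀ d x, insertLeft g P d x * T d = T d * insertRight g P (τ d) x) {ds : List D}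
    (hc : ds.IsChain fun x y => π x = y) (hn : ds.Nodup) (hπ : ∀ x, π x ∈ ds ↔ x ∈ ds)
    (vs : List D) (d : D) (hv : (d :: vs).IsChain fun x y => σ x = y)
    (hvs : ∀ x ∈ vs, x ∉ ds ∨ x ∈ ds.tail) :
    (ds.map (insertLeft g P d)).prod * ((d :: vs).map T).prod = ((d :: vs).map T).prod *
      (ds.map (insertRight g P (τ ((d :: vs).getLast (List.cons_ne_nil _ _))))).prod := by
  induction vs generalizing d with
  | nil => simpa using prod_map_mul_eq h d ds
  | cons e vs ih =>
    rw [List.isChain_cons_cons] at hv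
    rw [List.getLast_cons_cons, List.map_cons, List.prod_cons, ← mul_assoc, prod_map_mul_eq h,
      mul_assoc, mul_assoc, ← ih e hv.2 fun x hx => hvs x (List.mem_cons_of_mem _ hx)]
    congr 2
    have he : π (τ d) = e := (hτ d).trans hv.1
    rcases hvs e List.mem_cons_self with h1 | h1
    · rw [prod_insertLeft_of_notMem g P h1, prod_insertRight_of_notMem]
      rwa [← hπ, he]
    · rw [← he] at h1 ⊢
      exact prod_insertRight_eq_insertLeft g P π _ ds hc hn h1

/-- If the lists are cycles starting at the same dart, the insertions remain at its corner only. -/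
lemma insert_mul_prod_eq {g : C} {P T : D → C} {τ : D → D} {π σ : Equiv.Perm D} [Finite D]
    (hτ : ∀ d, π (τ d) = σ d)
    (h : ∀ d x, insertLeft g P d x * T d = T d * insertRight g P (τ d) x) (d : D) :
    g * ((orbitList π d).map P).prod * ((orbitList σ d).map T).prod =
      ((orbitList σ d).map T).prod * (((orbitList π d).map P).prod * g) := by
  obtain ⟨vs, hvs⟩ := orbitList_eq_cons σ d
  obtain ⟨ds, hds⟩ := orbitList_eq_cons π d
  obtain ⟨ds', hds'⟩ := orbitList_eq_concat π d
  obtain ⟨vs', hvs'⟩ := orbitList_eq_concat σ d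
  have key := prod_insertLeft_mul_prod hτ h (orbitList_isChain π d) (orbitList_nodup π d)
    (fun x => by simp [mem_orbitList]) vs d (hvs ▸ orbitList_isChain σ d) (fun x hx => by
      rw [hds]
      by_cases hxd : x = d
      · have := orbitList_nodup σ d
        rw [hvs, List.nodup_cons] at this
        exact absurd (hxd ▸ hx) this.1
      · by_cases hx' : x ∈ ds
        · exact Or.inr hx'
        · exact Or.inl (by simp [hxd, hx']))
  -- The last insertion sits after `τ (σ⁻¹ d) = π⁻¹ d`, the last letter of the word, so it is `g` at
  -- the right end.
  have hlast : (d :: vs).getLast (List.cons_ne_nil _ _) = σ⁻¹ d := by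
    have : d :: vs = vs' ++ [σ⁻¹ d] := hvs ▸ hvs'
    simp [this]
  have hτ' : τ (σ⁻¹ d) = π⁻¹ d := by
    rw [Equiv.Perm.eq_inv_iff_eq, hτ]; simp
  rw [hlast, hτ', ← hvs] at key
  have h1 : ((orbitList π d).map (insertLeft g P d)).prod = g * ((orbitList π d).map P).prod := by
    have := orbitList_nodup π d
    rw [hds, List.nodup_cons] at this
    rw [hds, List.map_cons, List.prod_cons, prod_insertLeft_of_notMem g P this.1, insertLeft,
      if_pos rfl, List.map_cons, List.prod_cons, mul_assoc]
  have h2 : ((orbitList π d).map (insertRight g P (π⁻¹ d))).prod =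
      ((orbitList π d).map P).prod * g := by
    have := orbitList_nodup π d
    rw [hds', List.nodup_append] at this
    have hnm : π⁻¹ d ∉ ds' := fun hm => this.2.2 _ hm _ (List.mem_singleton_self _) rfl
    rw [hds', List.map_append, List.prod_append, prod_insertRight_of_notMem g P hnm]
    simp [insertRight, mul_assoc]
  rw [h1, h2] at key
  exact key

end Insertion

/-! ### Star and plaquette operators as contractions; commutation within each type -/

section OperatorsAsContractions

variable {ι : Type*} [Fintype ι] [DecidableEq ι] {E : Type*} [Fintype E] [DecidableEq E]
variable {A : Type*} [Ring A] [HopfAlgebra ℂ A] (b : Module.Basis ι ℂ A)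

/-- The element of `A ⊗ M` representing the leg of a plaquette operator. -/
def plaquetteElement (d : Dart E) : A ⊗[ℂ] Matrix (E → ι) (E → ι) ℂ :=
  dualElement b (plaquetteLegLin b d)

/-- The action of an element of `A` at the darts of a list, in the convolution algebra. -/
def starConv (ds : List (Dart E)) : WithConv (A →ₗ[ℂ] Matrix (E → ι) (E → ι) ℂ) :=
  (ds.map fun d => toConv (starLegLin b d)).prod

lemma plaquetteOpOf_eq (L : SurfaceLattice E) (f : A →ₗ[ℂ] ℂ) (p : L.Plaquette) :
    plaquetteOpOf L b f p = contract f ((cycleList L.face p).map (plaquetteElement b)).prod := by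
  refine Eq.trans ?_ (contract_prod (cycleList L.face p) (fun _ i => b i)
    (fun d i => plaquetteLegLin b d (b.coord i)) f).symm
  simp only [plaquetteOpOf, plaquetteLeg_eq]

/-- The element of `A` representing a functional on the dual algebra. -/
def predual (w : DualAlg A →ₗ[ℂ] ℂ) : A := ∑ i, w (dualVec b i) • b i

lemma apply_predual (w : DualAlg A →ₗ[ℂ] ℂ) (f : DualAlg A) : f (predual b w) = w f := by
  have h := congr(w (toConv $(b.sum_dual_apply_smul_coord f.ofConv)))
  rw [toConv_ofConv] at h
  rw [← h, toConv_sum, map_sum, predual, map_sum]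
  refine Finset.sum_congr rfl fun i _ => ?_
  rw [map_smul, toConv_smul, map_smul, smul_eq_mul, smul_eq_mul, mul_comm]
  rfl

lemma starOpOf_eq (L : SurfaceLattice E) (w : DualAlg A →ₗ[ℂ] ℂ) (v : L.Vertex) :
    starOpOf L b w v = starConv b (cycleList L.rot⁻¹ v) (predual b w) := by
  rw [starConv, conv_prod_apply b]
  simp only [starOpOf, starLeg_eq, apply_predual]

lemma contract_plaquetteElement (f : A →ₗ[ℂ] ℂ) (d : Dart E) :
    contract f (plaquetteElement b d) = plaquetteLegLin b d f :=
  contract_dualElement b _ f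

lemma commute_contract_prod {X : Matrix (E → ι) (E → ι) ℂ} {ds : List (Dart E)}
    (h : ∀ d ∈ ds, ∀ f, Commute X (plaquetteLegLin b d f)) (f : A →ₗ[ℂ] ℂ) :
    Commute X (contract f (ds.map (plaquetteElement b)).prod) := by
  induction ds generalizing f with
  | nil =>
    rw [List.map_nil, List.prod_nil, Algebra.TensorProduct.one_def, contract_tmul]
    exact (Commute.one_right X).smul_right _
  | cons d ds ih =>
    rw [List.map_cons, List.prod_cons, contract_mul b]
    refine Commute.sum_right _ _ _ fun i _ => Commute.sum_right _ _ _ fun j _ => ?_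
    refine Commute.smul_right (Commute.mul_right ?_ ?_) _
    · rw [contract_plaquetteElement]
      exact h d List.mem_cons_self _
    · exact ih (fun d hd => h d (List.mem_cons_of_mem _ hd)) _

lemma commute_starConv {X : Matrix (E → ι) (E → ι) ℂ} {ds : List (Dart E)}
    (h : ∀ d ∈ ds, ∀ x, Commute X (starLegLin b d x)) (z : A) :
    Commute X (starConv b ds z) := by
  induction ds generalizing z with
  | nil =>
    rw [starConv, List.map_nil, List.prod_nil, LinearMap.convOne_apply]
    exact Algebra.commutes' _ _ |>.symm
  | cons d ds ih =>
    rw [starConv, List.map_cons, List.prod_cons, (ℛ ℂ z).convMul_apply]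
    refine Commute.sum_right _ _ _ fun i _ => Commute.mul_right ?_ ?_
    · exact h d List.mem_cons_self _
    · exact ih (fun d hd => h d (List.mem_cons_of_mem _ hd)) _

lemma contract_prod_commute {ds ds' : List (Dart E)} (h : ds.Disjoint ds') (f g : A →ₗ[ℂ] ℂ) :
    Commute (contract f (ds.map (plaquetteElement b)).prod)
      (contract g (ds'.map (plaquetteElement b)).prod) :=
  commute_contract_prod b (fun d' hd' _ => (commute_contract_prod b (fun d hd _ =>
    plaquetteLegLin_commute b (fun e => h hd (by subst e; exact hd')) _ _) _).symm) _

lemma starConv_commute {ds ds' : List (Dart E)} (h : ds.Disjoint ds') (x y : A) :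
    Commute (starConv b ds x) (starConv b ds' y) :=
  commute_starConv b (fun d' hd' _ => (commute_starConv b (fun d hd _ =>
    starLegLin_commute b (fun e => h hd (by subst e; exact hd')) _ _) _).symm) _

lemma cycleList_disjoint {D : Type*} [Finite D] (π : Equiv.Perm D) {p q : Cycles π} (h : p ≠ q) :
    (cycleList π p).Disjoint (cycleList π q) := by
  intro x hx hy
  simp only [cycleList, mem_orbitList] at hx hy
  refine h ?_
  rw [← Quotient.out_eq p, ← Quotient.out_eq q]
  exact Quotient.sound (hx.trans hy.symm)

lemma plaquetteOpOf_commute (L : SurfaceLattice E) (f g : A →ₗ[ℂ] ℂ) {p q : L.Plaquette}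
    (h : p ≠ q) : Commute (plaquetteOpOf L b f p) (plaquetteOpOf L b g q) := by
  rw [plaquetteOpOf_eq, plaquetteOpOf_eq]
  exact contract_prod_commute b (cycleList_disjoint _ h) _ _

lemma starOpOf_commute (L : SurfaceLattice E) (w w' : DualAlg A →ₗ[ℂ] ℂ) {p q : L.Vertex}
    (h : p ≠ q) : Commute (starOpOf L b w p) (starOpOf L b w' q) := by
  rw [starOpOf_eq, starOpOf_eq]
  exact starConv_commute b (cycleList_disjoint _ h) _ _

end OperatorsAsContractions

/-! ### Star operators commute with plaquette operators -/

section MixedCommutation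

variable {ι : Type*} [Fintype ι] [DecidableEq ι] {E : Type*} [Fintype E] [DecidableEq E]
variable {A : Type*} [Ring A] [HopfAlgebra ℂ A] (b : Module.Basis ι ℂ A)

/-- The leg of a star operator as an element of the convolution algebra over `A ⊗ M`. -/
def starLegConv (d : Dart E) : WithConv (A →ₗ[ℂ] A ⊗[ℂ] Matrix (E → ι) (E → ι) ℂ) :=
  toConv ((Algebra.TensorProduct.includeRight : Matrix (E → ι) (E → ι) ℂ →ₐ[ℂ] A ⊗[ℂ] Matrix (E → ι) (E → ι) ℂ).toLinearMap ∘ₗ starLegLin b d)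

/-- The leg of a plaquette operator as a constant of the convolution algebra over `A ⊗ M`. -/
def plaquetteConst (d : Dart E) : WithConv (A →ₗ[ℂ] A ⊗[ℂ] Matrix (E → ι) (E → ι) ℂ) :=
  constConv A (plaquetteElement b d)

/-- The universal element `h ↦ h ⊗ 1`. -/
def universalConv : WithConv (A →ₗ[ℂ] A ⊗[ℂ] Matrix (E → ι) (E → ι) ℂ) :=
  toConv (Algebra.TensorProduct.includeLeft : A →ₐ[ℂ] A ⊗[ℂ] Matrix (E → ι) (E → ι) ℂ).toLinearMap

/-- Only `d` and its flip lie on the link of `d`. The two exchange relations on a link account for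
the two insertions; every other letter commutes with the star leg. -/
lemma insertLeft_mul_starLegConv (hA : IsInvolutory A) (d x : Dart E) :
    insertLeft universalConv (plaquetteConst b) d x * starLegConv b d =
      starLegConv b d * insertRight universalConv (plaquetteConst b)
        (flipDart E d) x := by
  have hne : d ≠ flipDart E d := fun h => by
    have := congrArg Prod.snd h
    simp [flipDart] at this
  by_cases h1 : x = d
  · subst h1
    rw [insertLeft, if_pos rfl, insertRight, if_neg hne]
    ext1
    refine LinearMap.ext fun h => ?_
    change (universalConv * constConv A (plaquetteElement b x) * starLegConv b x :
      WithConv (A →ₗ[ℂ] A ⊗[ℂ] Matrix (E → ι) (E → ι) ℂ)) h =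
      (starLegConv b x * constConv A (plaquetteElement b x)) h
    rw [mul_assoc, (ℛ ℂ h).convMul_apply, mul_constConv_apply]
    simp only [constConv_mul_apply]
    refine contract_ext b fun f => ?_
    rw [map_sum]
    change ∑ j ∈ _, contract f ((_ ⊗ₜ 1) * (plaquetteElement b x * (1 ⊗ₜ _))) =
      contract f ((1 ⊗ₜ _) * _)
    simp only [contract_left_mul, contract_mul_right, contract_right_mul,
      contract_plaquetteElement, sum_plaquetteLegLin_mul_starLegLin]
  rw [insertLeft, if_neg h1]
  by_cases h2 : x = flipDart E d
  · subst h2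
    rw [insertRight, if_pos rfl, ← mul_assoc]
    ext1
    refine LinearMap.ext fun h => ?_
    change (constConv A (plaquetteElement b (flipDart E d)) * starLegConv b d) h =
      (starLegConv b d * constConv A (plaquetteElement b (flipDart E d)) * universalConv :
        WithConv (A →ₗ[ℂ] A ⊗[ℂ] Matrix (E → ι) (E → ι) ℂ)) h
    rw [(ℛ ℂ h).convMul_apply (starLegConv b d * _), constConv_mul_apply]
    simp only [mul_constConv_apply]
    refine contract_ext b fun f => ?_
    rw [map_sum]
    change contract f (_ * (1 ⊗ₜ _)) =
      ∑ j ∈ _, contract f ((1 ⊗ₜ _) * plaquetteElement b _ * (_ ⊗ₜ 1))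
    simp only [contract_mul_left, contract_mul_right, contract_right_mul,
      contract_plaquetteElement, plaquetteLegLin_flip_mul_starLegLin b hA]
  · rw [insertRight, if_neg h2]
    ext1
    refine LinearMap.ext fun h => ?_
    change (constConv A (plaquetteElement b x) * starLegConv b d) h =
      (starLegConv b d * constConv A (plaquetteElement b x)) h
    rw [constConv_mul_apply, mul_constConv_apply]
    refine contract_ext b fun f => ?_
    change contract f (_ * (1 ⊗ₜ _)) = contract f ((1 ⊗ₜ _) * _)
    rw [contract_mul_right, contract_right_mul, contract_plaquetteElement]
    refine plaquetteLegLin_starLegLin_commute b (fun he => ?_) _ _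
    obtain ⟨e, s⟩ := d
    obtain ⟨e', s'⟩ := x
    simp only at he
    subst he
    cases s <;> cases s' <;> simp [flipDart] at h1 h2

lemma prod_starLegConv (vs : List (Dart E)) (h : A) :
    (vs.map (starLegConv b)).prod h = (1 : A) ⊗ₜ[ℂ] starConv b vs h := by
  induction vs generalizing h with
  | nil => 
    simp [starConv, LinearMap.convOne_apply, Algebra.algebraMap_eq_smul_one,
      Algebra.TensorProduct.one_def]
  | cons d vs ih =>
    rw [starConv, List.map_cons, List.prod_cons, List.map_cons, List.prod_cons,
      (ℛ ℂ h).convMul_apply, (ℛ ℂ h).convMul_apply, TensorProduct.tmul_sum]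
    refine Finset.sum_congr rfl fun i _ => ?_
    rw [ih]
    change ((1 : A) ⊗ₜ _) * _ = _
    simp [starConv]

lemma prod_constConv (ds : List (Dart E)) :
    (ds.map (plaquetteConst b)).prod =
      constConv A (ds.map (plaquetteElement b)).prod := by
  rw [map_list_prod, List.map_map]; rfl

/-- An element of `A` is cocommutative if it does not distinguish the orders of a product of
functionals. -/
def IsCocommutative (z : A) : Prop := ∀ f g : DualAlg A, (f * g) z = (g * f) z

lemma sum_dual_mul_smul (z : A) {V : Type*} [AddCommGroup V] [Module ℂ V]
    (F : A →ₗ[ℂ] A →ₗ[ℂ] V) :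
    ∑ k, ∑ l, (dualVec b k * dualVec b l) z • F (b k) (b l) =
      ∑ i ∈ (ℛ ℂ z).index, F ((ℛ ℂ z).left i) ((ℛ ℂ z).right i) := by
  simp only [(ℛ ℂ z).convMul_apply, Finset.sum_smul]
  rw [Finset.sum_congr rfl fun k _ => Finset.sum_comm, Finset.sum_comm]
  refine Finset.sum_congr rfl fun i _ => ?_
  rw [← sum_coord_smul b F ((ℛ ℂ z).left i), LinearMap.sum_apply]
  refine Finset.sum_congr rfl fun k _ => ?_
  rw [LinearMap.smul_apply, ← sum_coord_smul b (F (b k)) ((ℛ ℂ z).right i), Finset.smul_sum]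
  refine Finset.sum_congr rfl fun l _ => ?_
  rw [smul_smul]; rfl

lemma IsCocommutative.sum_eq (b : Module.Basis ι ℂ A) {z : A} (hz : IsCocommutative z)
    {V : Type*} [AddCommGroup V] [Module ℂ V] (F : A →ₗ[ℂ] A →ₗ[ℂ] V) :
    ∑ i ∈ (ℛ ℂ z).index, F ((ℛ ℂ z).left i) ((ℛ ℂ z).right i) =
      ∑ i ∈ (ℛ ℂ z).index, F ((ℛ ℂ z).right i) ((ℛ ℂ z).left i) := by
  rw [← sum_dual_mul_smul b z F]
  refine Eq.trans ?_ (sum_dual_mul_smul b z F.flip)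
  rw [Finset.sum_comm]
  refine Finset.sum_congr rfl fun k _ => Finset.sum_congr rfl fun l _ => ?_
  rw [hz]; rfl

/-- The contraction as a linear map in the functional. -/
def contractLin {M : Type*} [Ring M] [Algebra ℂ M] (X : A ⊗[ℂ] M) : (A →ₗ[ℂ] ℂ) →ₗ[ℂ] M :=
  (TensorProduct.lid ℂ M).toLinearMap ∘ₗ (LinearMap.rTensorHom M).flip X

lemma contractLin_apply {M : Type*} [Ring M] [Algebra ℂ M] (X : A ⊗[ℂ] M) (f : A →ₗ[ℂ] ℂ) :
    contractLin X f = contract f X := rfl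

/-- The operators of a face and of a vertex commute if their cycles start at the same dart. -/
lemma contract_commute_starConv (hA : IsInvolutory A) (L : SurfaceLattice E) {f : A →ₗ[ℂ] ℂ}
    (hf : ∀ x y, f (x * y) = f (y * x)) {z : A} (hz : IsCocommutative z) (d : Dart E) :
    Commute (contract f ((orbitList L.face d).map (plaquetteElement b)).prod)
      (starConv b (orbitList L.rot⁻¹ d) z) := by
  set F := ((orbitList L.face d).map (plaquetteElement b)).prod with hF
  set q := starConv b (orbitList L.rot⁻¹ d) with hq
  have key := insert_mul_prod_eq (π := L.face) (σ := L.rot⁻¹) (τ := flipDart E)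
    (fun d => by simp [SurfaceLattice.face, flipDart])
    (insertLeft_mul_starLegConv b hA) d
  rw [prod_constConv, ← hF] at key
  set T := ((orbitList L.rot⁻¹ d).map (starLegConv b)).prod with hT
  have hTq : ∀ h, T h = (1 : A) ⊗ₜ[ℂ] q h := prod_starLegConv b _
  set gS : WithConv (A →ₗ[ℂ] A ⊗[ℂ] Matrix (E → ι) (E → ι) ℂ) :=
    toConv ((Algebra.TensorProduct.includeLeft : A →ₐ[ℂ] A ⊗[ℂ] Matrix (E → ι) (E → ι) ℂ).toLinearMap ∘ₗ antipode ℂ)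
    with hgS
  have hS : gS * universalConv = 1 := antipode_algHom_conv _
  -- Multiplying the telescoped identity by the convolution inverse of the universal letter exhibits
  -- `F T` as a conjugate of `T F`.
  have h1 : constConv A F * T = gS * (T * constConv A F * universalConv) := by
    rw [mul_assoc T, ← key, ← mul_assoc, ← mul_assoc, hS]
    exact congrArg (· * T) (one_mul (constConv A F)).symm
  have h2 := congr(contract f ($h1 z))
  rw [constConv_mul_apply, hTq, contract_mul_right] at h2
  have h3 : ∀ h, (T * constConv A F * universalConv : WithConv (A →ₗ[ℂ] A ⊗[ℂ]
        Matrix (E → ι) (E → ι) ℂ)) h =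
      ∑ k ∈ (ℛ ℂ h).index, (1 ⊗ₜ[ℂ] q ((ℛ ℂ h).left k)) * F * ((ℛ ℂ h).right k ⊗ₜ[ℂ] 1) := by
    intro h
    rw [(ℛ ℂ h).convMul_apply]
    simp only [mul_constConv_apply, hTq]
    rfl
  -- Cocommutativity of `z` replaces `S(z₁) q(z₂) F z₃` by `S(z₃) q(z₁) F z₂`. Traciality of `f`
  -- then brings `z₂ S(z₃)` together, where it cancels.
  have h4 := hz.sum_eq b (((LinearMap.mul ℂ _).compl₁₂ gS.ofConv
    (T * constConv A F * universalConv : WithConv (A →ₗ[ℂ] A ⊗[ℂ]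
      Matrix (E → ι) (E → ι) ℂ)).ofConv).compr₂ (contract f))
  simp only [LinearMap.compr₂_apply, LinearMap.compl₁₂_apply, LinearMap.mul_apply'] at h4
  have h5 := congr(TensorProduct.lift ((LinearMap.mul ℂ _).compl₁₂ q.ofConv
    (contractLin F ∘ₗ mulRightDual f)) $(sum_tmul_cancel cancels_mulAntipode z))
  simp only [map_sum, TensorProduct.lift.tmul, LinearMap.compl₁₂_apply, LinearMap.comp_apply,
    LinearMap.mul_apply', mulRightDual_one, contractLin_apply, mulAntipode_apply] at h5
  rw [Commute, SemiconjBy, h2, (ℛ ℂ z).convMul_apply, map_sum, h4, ← h5]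
  refine Finset.sum_congr rfl fun i _ => ?_
  rw [h3, Finset.mul_sum, map_sum]
  refine Finset.sum_congr rfl fun k _ => ?_
  change contract f ((antipode ℂ _ ⊗ₜ 1) * _) = _
  rw [contract_left_mul, contract_mul_left, contract_right_mul]
  have h6 : ∀ u v : A, mulRightDual (mulLeftDual f u) v = mulRightDual f (v * u) := fun u v => by
    ext x
    rw [mulRightDual_apply, mulLeftDual_apply, mulRightDual_apply, hf, mul_assoc]
  rw [h6]

lemma contract_orbitList_eq (b : Module.Basis ι ℂ A) {f : A →ₗ[ℂ] ℂ}
    (hf : ∀ x y, f (x * y) = f (y * x)) (π : Equiv.Perm (Dart E)) {d x : Dart E}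
    (h : x ∈ orbitList π d) :
    contract f ((orbitList π x).map (plaquetteElement b)).prod =
      contract f ((orbitList π d).map (plaquetteElement b)).prod := by
  obtain ⟨s, t, h1, h2⟩ := orbitList_rotate π h
  have hd : t.Disjoint s := (List.disjoint_of_nodup_append (h1 ▸ orbitList_nodup π d)).symm
  rw [h1, h2, List.map_append, List.map_append, List.prod_append, List.prod_append]
  exact contract_mul_comm b hf fun f g => contract_prod_commute b hd f g

lemma starConv_orbitList_eq (b : Module.Basis ι ℂ A) {z : A} (hz : IsCocommutative z)
    (π : Equiv.Perm (Dart E)) {d x : Dart E} (h : x ∈ orbitList π d) :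
    starConv b (orbitList π x) z = starConv b (orbitList π d) z := by
  obtain ⟨s, t, h1, h2⟩ := orbitList_rotate π h
  have hd : t.Disjoint s := (List.disjoint_of_nodup_append (h1 ▸ orbitList_nodup π d)).symm
  have happ : ∀ s t : List (Dart E), starConv b (s ++ t) z = ∑ i ∈ (ℛ ℂ z).index,
      starConv b s ((ℛ ℂ z).left i) * starConv b t ((ℛ ℂ z).right i) := fun s t => by
    rw [starConv, List.map_append, List.prod_append, (ℛ ℂ z).convMul_apply]; rfl
  rw [h1, h2, happ, happ]
  refine (hz.sum_eq b ((LinearMap.mul ℂ _).compl₁₂ (starConv b t).ofConv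
    (starConv b s).ofConv)).trans ?_
  exact Finset.sum_congr rfl fun i _ => (starConv_commute b hd _ _).eq

lemma plaquetteOpOf_starOpOf_commute (hA : IsInvolutory A) (L : SurfaceLattice E)
    {f : A →ₗ[ℂ] ℂ} (hf : ∀ x y, f (x * y) = f (y * x)) {w : DualAlg A →ₗ[ℂ] ℂ}
    (hw : ∀ x y, w (x * y) = w (y * x)) (p : L.Plaquette) (v : L.Vertex) :
    Commute (plaquetteOpOf L b f p) (starOpOf L b w v) := by
  rw [plaquetteOpOf_eq, starOpOf_eq]
  have hz : IsCocommutative (predual b w) := fun f g => by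
    rw [apply_predual, apply_predual, hw]
  have hface : ∀ x, L.face (flipDart E x) = L.rot⁻¹ x := fun x => by
    simp [SurfaceLattice.face, flipDart]
  -- If plaquette and vertex share a dart, both cycles may be restarted there. If not, they share no
  -- link: a common link run oppositely would make the next dart round the vertex a common dart.
  by_cases h : ∃ d, d ∈ cycleList L.face p ∧ d ∈ cycleList L.rot⁻¹ v
  · obtain ⟨d, hp, hv⟩ := h
    rw [cycleList] at hp hv
    rw [cycleList, ← contract_orbitList_eq b hf L.face hp, cycleList,
      ← starConv_orbitList_eq b hz L.rot⁻¹ hv]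
    exact contract_commute_starConv b hA L hf hz d
  · push Not at h
    refine commute_starConv b (fun d hd x => (commute_contract_prod b (fun d' hd' g => ?_) _).symm) _
    refine (plaquetteLegLin_starLegLin_commute b (fun he => ?_) _ _).symm
    obtain ⟨e, s⟩ := d
    obtain ⟨e', s'⟩ := d'
    simp only at he
    subst he
    have hmem : ∀ x, x ∈ cycleList L.rot⁻¹ v → flipDart E x ∉ cycleList L.face p := by
      intro x hx hx'
      refine h (L.rot⁻¹ x) ?_ ?_
      · rw [← hface]
        simp only [cycleList, mem_orbitList] at hx' ⊢
        exact hx'.apply_right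
      · simp only [cycleList, mem_orbitList] at hx ⊢
        exact hx.apply_right
    by_cases hs : s = s'
    · subst hs
      exact h _ hd' hd
    · have : flipDart E (e', s) = (e', s') := by
        cases s <;> cases s' <;> simp [flipDart] at hs ⊢
      exact hmem _ hd (this ▸ hd')

end MixedCommutation

/-! ### Products over all cycles as sums over labellings of the darts -/

section NoncommutativeExpansion

lemma noncommProd_univ_eq_ofFn {Q M : Type*} [Fintype Q] [Monoid M] {m : ℕ} (e : Fin m ≃ Q)
    (f : Q → M) (h : (↑(Finset.univ : Finset Q) : Set Q).Pairwise fun p q => Commute (f p) (f q)) :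
    Finset.univ.noncommProd f h = (List.ofFn fun k => f (e k)).prod := by
  classical
  have hs : (Finset.univ : Finset Q) = (List.ofFn e).toFinset := by
    ext q
    simpa using ⟨e.symm q, by simp⟩
  refine (Finset.noncommProd_congr hs (fun _ _ => rfl) h).trans
    ((Finset.noncommProd_toFinset _ _ _ (List.nodup_ofFn.2 e.injective)).trans ?_)
  rw [List.map_ofFn]
  rfl

variable {ι : Type*} [Fintype ι] [DecidableEq ι] {E : Type*} [Fintype E] [DecidableEq E]

/-- On the factor of `e` only the two darts of `e` act, and their actions commute, so the order of
the list is immaterial. -/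
lemma prod_map_mulSingle {R : Type*} [Monoid R] (G : Dart E → R)
    (hG : ∀ e, Commute (G (e, true)) (G (e, false))) {l : List (Dart E)} (hn : l.Nodup)
    (hl : ∀ d, d ∈ l) :
    (l.map fun d => (Pi.mulSingle d.1 (G d) : E → R)).prod =
      fun e => G (e, true) * G (e, false) := by
  funext e
  rw [Pi.list_prod_apply, List.map_map]
  have hp : (l.filter (fun d => d.1 = e)).Perm [(e, true), (e, false)] := by
    refine (List.perm_ext_iff_of_nodup (hn.filter _) (by simp)).2 fun d => ?_
    obtain ⟨e', s⟩ := d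
    cases s <;> simp [hl]
  have hperm : l.Perm ([(e, true), (e, false)] ++ l.filter (fun d => ¬ d.1 = e)) := by
    have h1 := (List.filter_append_perm (fun d : Dart E => decide (d.1 = e)) l).symm
    refine h1.trans (List.Perm.append hp ?_)
    simp
  have hne : ∀ d : Dart E, d.1 ≠ e → (Pi.mulSingle d.1 (G d) : E → R) e = 1 := fun d hd =>
    Pi.mulSingle_eq_of_ne hd.symm _
  rw [List.Perm.prod_eq' (hperm.map _) ?_]
  · rw [List.map_append, List.prod_append]
    have h1 : ((l.filter (fun d => ¬ d.1 = e)).map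
        ((fun f : E → R => f e) ∘ fun d => Pi.mulSingle d.1 (G d))).prod = 1 := by
      refine List.prod_eq_one fun x hx => ?_
      simp only [List.mem_map, List.mem_filter] at hx
      obtain ⟨d, ⟨_, hd⟩, rfl⟩ := hx
      exact hne d (by simpa using hd)
    rw [h1]
    simp
  · rw [List.pairwise_map]
    refine hn.imp_of_mem fun {d d'} _ _ hdd => ?_
    by_cases h1 : d.1 = e
    · by_cases h2 : d'.1 = e
      · obtain ⟨x, s⟩ := d
        obtain ⟨y, t⟩ := d'
        simp only at h1 h2
        subst h1 h2
        cases s <;> cases t <;> first | exact absurd rfl hdd | skip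
        · simpa using (hG _).symm
        · simpa using hG _
      · simp [hne d' h2]
    · simp [hne d h1]

/-- The darts, listed cycle by cycle. -/
lemma cycleList_bijective {D : Type*} [Finite D] (π : Equiv.Perm D) :
    Function.Bijective fun x : (Σ q : Cycles π, Fin (cycleList π q).length) =>
      (cycleList π x.1).get x.2 := by
  constructor
  · rintro ⟨q, k⟩ ⟨q', k'⟩ h
    simp only at h
    have hq : q = q' := by
      by_contra hne
      exact cycleList_disjoint π hne (List.get_mem _ k) (h ▸ List.get_mem _ k')
    subst hq
    have := (List.nodup_iff_injective_get.1 (orbitList_nodup π _)) h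
    rw [this]
  · intro d
    have hd : d ∈ cycleList π (Quotient.mk _ d) := by
      rw [cycleList, mem_orbitList]
      exact Quotient.exact (Quotient.out_eq (Quotient.mk (Equiv.Perm.SameCycle.setoid π) d))
    obtain ⟨k, hk⟩ := List.get_of_mem hd
    exact ⟨⟨_, k⟩, hk⟩

lemma flatten_cycleList {D : Type*} [Finite D] (π : Equiv.Perm D) {m : ℕ} (e : Fin m ≃ Cycles π) :
    (List.ofFn fun k => cycleList π (e k)).flatten.Nodup ∧
      ∀ d, d ∈ (List.ofFn fun k => cycleList π (e k)).flatten := by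
  constructor
  · rw [List.nodup_flatten]
    refine ⟨fun l hl => ?_, ?_⟩
    · obtain ⟨k, rfl⟩ := (List.mem_ofFn' _ _).1 hl
      exact orbitList_nodup π _
    · rw [List.pairwise_ofFn]
      intro i j hij
      exact cycleList_disjoint π fun h => hij.ne (e.injective h)
  · intro d
    obtain ⟨⟨q, k⟩, hk⟩ := (cycleList_bijective π).2 d
    rw [List.mem_flatten]
    refine ⟨cycleList π q, (List.mem_ofFn' _ _).2 ⟨e.symm q, by simp⟩, ?_⟩
    rw [← hk]
    exact List.get_mem _ _

/-- The product of the operators of all cycles, expanded over the labellings of the darts. -/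
lemma noncommProd_cycles_eq_sum (π : Equiv.Perm (Dart E)) (G : Dart E → ι → Matrix ι ι ℂ)
    (hG : ∀ e i j, Commute (G (e, true) i) (G (e, false) j))
    (W : ∀ q : Cycles π, (Fin (cycleList π q).length → ι) → ℂ)
    (X : Cycles π → Matrix (E → ι) (E → ι) ℂ)
    (hX : ∀ q, X q = ∑ l : Fin (cycleList π q).length → ι, W q l • (List.ofFn fun k =>
      siteTensorHom (Pi.mulSingle ((cycleList π q).get k).1 (G ((cycleList π q).get k) (l k)))).prod)
    (h : (↑(Finset.univ : Finset (Cycles π)) : Set (Cycles π)).Pairwise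
      fun p q => Commute (X p) (X q)) :
    Finset.univ.noncommProd X h = ∑ a : Dart E → ι,
      (∏ q, W q fun k => a ((cycleList π q).get k)) •
        siteTensor fun e => G (e, true) (a (e, true)) * G (e, false) (a (e, false)) := by
  classical
  let e := (Fintype.equivFin (Cycles π)).symm
  rw [noncommProd_univ_eq_ofFn e]
  simp only [hX]
  have h1 := (MultilinearMap.mkPiAlgebraFin ℂ _ (Matrix (E → ι) (E → ι) ℂ)).map_sum
    (fun k (l : Fin (cycleList π (e k)).length → ι) => W (e k) l • (List.ofFn fun j =>
      siteTensorHom (Pi.mulSingle ((cycleList π (e k)).get j).1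
        (G ((cycleList π (e k)).get j) (l j)))).prod)
  simp only [MultilinearMap.map_smul_univ] at h1
  simp only [MultilinearMap.mkPiAlgebraFin_apply] at h1
  rw [h1]
  let ε := Equiv.ofBijective _ (cycleList_bijective π)
  -- As the cycles partition the darts, labelling all darts is the same as labelling each cycle
  -- independently.
  let Φ : (Dart E → ι) ≃ (∀ k, Fin (cycleList π (e k)).length → ι) :=
    ((ε.arrowCongr (Equiv.refl ι)).symm.trans (Equiv.piCurry fun _ _ => ι)).trans
      (Equiv.piCongrLeft _ e).symm
  refine (Fintype.sum_equiv Φ _ _ fun a => ?_).symm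
  have hΦ : ∀ k j, Φ a k j = a ((cycleList π (e k)).get j) := fun k j => rfl
  simp only [hΦ]
  rw [← e.prod_comp]
  congr 1
  have h2 := prod_map_mulSingle (fun d => G d (a d)) (fun e => hG e _ _)
    (flatten_cycleList π e).1 (flatten_cycleList π e).2
  rw [← h2]
  change siteTensorHom _ = _
  rw [map_list_prod, List.map_map, List.map_flatten, List.prod_flatten, List.map_map,
    List.map_ofFn]
  congr 1
  refine congrArg List.ofFn (funext fun k => ?_)
  simp only [Function.comp_apply]
  congr 1
  conv_lhs => rw [← List.ofFn_get (cycleList π (e k)), List.map_ofFn]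
  rfl

end NoncommutativeExpansion

/-! ### Factorization of the transfer matrix -/

section Factorization

variable {ι : Type*} [Fintype ι] [DecidableEq ι] {E : Type*} [Fintype E] [DecidableEq E]
variable {A : Type*} [Ring A] [HopfAlgebra ℂ A] (b : Module.Basis ι ℂ A)

/-- The action on a link of the leg of a plaquette operator, up to the antipode. -/
def coproductSite (s : Bool) (f : A →ₗ[ℂ] ℂ) : A →ₗ[ℂ] A := if s then evalRight f else evalLeft f

/-- The identity `∑ bᵢ ⊗ P(bⁱ ∘ S) = ∑ S(bᵢ) ⊗ P(bⁱ)` moves the antipode from the leg into the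
trace, where `transferMatrix` has it. -/
lemma plaquetteElement_eq_sum_crossing (d : Dart E) : plaquetteElement b d =
    ∑ i, crossing d.2 (b i) ⊗ₜ[ℂ] siteOp b d.1 (coproductSite d.2 (b.coord i)) := by
  refine contract_ext b fun f => ?_
  rw [contract_plaquetteElement, map_sum]
  simp only [contract_tmul]
  obtain ⟨e, _ | _⟩ := d
  · have h := congr(siteOpLin b e (evalLeftLin $(b.sum_dual_apply_smul_coord (f ∘ₗ antipode ℂ))))
    rw [map_sum, map_sum] at h
    refine h.symm.trans ?_
    refine Finset.sum_congr rfl fun i _ => ?_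
    rw [map_smul, map_smul]
    rfl
  · have h := congr(siteOpLin b e (evalRightLin $(b.sum_dual_apply_smul_coord f)))
    rw [map_sum, map_sum] at h
    refine h.symm.trans ?_
    refine Finset.sum_congr rfl fun i _ => ?_
    rw [map_smul, map_smul]
    rfl

lemma plaquetteOpOf_eq_sum_crossing (L : SurfaceLattice E) (f : A →ₗ[ℂ] ℂ) (p : L.Plaquette) :
    plaquetteOpOf L b f p = ∑ l : Fin (cycleList L.face p).length → ι,
      f (List.ofFn fun k => crossing ((cycleList L.face p).get k).2 (b (l k))).prod •
        (List.ofFn fun k => siteTensorHom (Pi.mulSingle ((cycleList L.face p).get k).1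
          (LinearMap.toMatrix b b
            (coproductSite ((cycleList L.face p).get k).2 (b.coord (l k)))))).prod := by
  rw [plaquetteOpOf_eq, funext (plaquetteElement_eq_sum_crossing b)]
  refine (contract_prod _ _ _ _).trans ?_
  simp only [siteOp_eq_siteTensor]

lemma starOpOf_eq_sum_starSite (L : SurfaceLattice E) (w : DualAlg A →ₗ[ℂ] ℂ) (v : L.Vertex) :
    starOpOf L b w v = ∑ l : Fin (cycleList L.rot⁻¹ v).length → ι,
      w (List.ofFn fun k => dualVec b (l k)).prod •
        (List.ofFn fun k => siteTensorHom (Pi.mulSingle ((cycleList L.rot⁻¹ v).get k).1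
          (LinearMap.toMatrix b b
            (starSite ((cycleList L.rot⁻¹ v).get k).2 (b (l k)))))).prod := by
  simp only [starOpOf, starLeg_eq, starLegLin_apply, siteOp_eq_siteTensor]

/-- The contraction of the labels of a link of the transfer matrix. -/
lemma sum_link_eq [Module.Finite ℂ A] (hA : IsInvolutory A) (i j a a' c c' : ι) :
    ∑ u, blueWeight 1 [b j, b c', crossing false (b u), crossing false (b c)] *
      redWeight 1 [dualVec b u, dualVec b a', dualVec b i, dualVec b a] =
      Module.finrank ℂ A *
        (LinearMap.toMatrix b b (coproductSite true (b.coord a)) *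
          LinearMap.toMatrix b b (coproductSite false (b.coord a')) *
          (LinearMap.toMatrix b b (starSite true (b c)) *
            LinearMap.toMatrix b b (starSite false (b c')))) i j := by
  rw [sum_link_weights hA b]
  simp only [← LinearMap.toMatrix_comp b b b]
  rw [LinearMap.toMatrix_apply]
  rfl

theorem transferMatrix_eq [Module.Finite ℂ A] (hA : IsInvolutory A) (L : SurfaceLattice E)
    (zS : A) (zTs : DualAlg A)
    (hB : (↑(Finset.univ : Finset L.Plaquette) : Set L.Plaquette).Pairwise
      fun p q => Commute (plaquetteOp L b zS p) (plaquetteOp L b zS q))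
    (hS : (↑(Finset.univ : Finset L.Vertex) : Set L.Vertex).Pairwise
      fun v w => Commute (starOp L b zTs v) (starOp L b zTs w)) :
    transferMatrix L b 1 zS zTs 1 = ((Module.finrank ℂ A : ℂ) ^ Fintype.card E) •
      (Finset.univ.noncommProd (plaquetteOp L b zS) hB *
        Finset.univ.noncommProd (starOp L b zTs) hS) := by
  rw [noncommProd_cycles_eq_sum L.face
    (fun d i => LinearMap.toMatrix b b (coproductSite d.2 (b.coord i)))
    (X := plaquetteOp L b zS) (hG := fun e i j => by
      change _ * _ = _ * _
      rw [← LinearMap.toMatrix_comp b b b, ← LinearMap.toMatrix_comp b b b]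
      exact congrArg _ (evalRight_evalLeft_comm _ _))
    (hX := plaquetteOpOf_eq_sum_crossing b L (tr A ∘ₗ LinearMap.mulLeft ℂ zS)),
    noncommProd_cycles_eq_sum L.rot⁻¹
    (fun d i => LinearMap.toMatrix b b (starSite d.2 (b i)))
    (X := starOp L b zTs) (hG := fun e i j => by
      change _ * _ = _ * _
      rw [← LinearMap.toMatrix_comp b b b, ← LinearMap.toMatrix_comp b b b]
      exact congrArg _ (starSite_comm (by simp) _ _))
    (hX := starOpOf_eq_sum_starSite b L (cotr A ∘ₗ LinearMap.mulLeft ℂ zTs))]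
  ext out inp
  rw [Matrix.smul_apply, Finset.sum_mul_sum, Matrix.sum_apply, Finset.smul_sum, transferMatrix,
    Matrix.of_apply]
  refine Finset.sum_congr rfl fun a _ => ?_
  rw [Matrix.sum_apply, Finset.smul_sum]
  refine Finset.sum_congr rfl fun c _ => ?_
  rw [Matrix.smul_mul, Matrix.mul_smul, ← siteTensor_mul, Matrix.smul_apply, Matrix.smul_apply]
  have hp : ∀ p : L.Plaquette,
      blueWeight zS ((cycleList L.face p).map fun d => crossing d.2 (b (a d))) =
      (tr A ∘ₗ LinearMap.mulLeft ℂ zS) (List.ofFn fun k =>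
        crossing ((cycleList L.face p).get k).2 (b (a ((cycleList L.face p).get k)))).prod := by
    intro p
    conv_lhs => rw [← List.ofFn_get (cycleList L.face p), List.map_ofFn]
    rfl
  have hv : ∀ v : L.Vertex,
      redWeight zTs ((cycleList L.rot⁻¹ v).map fun d => dualVec b (c d)) =
      (cotr A ∘ₗ LinearMap.mulLeft ℂ zTs) (List.ofFn fun k =>
        dualVec b (c ((cycleList L.rot⁻¹ v).get k))).prod := by
    intro v
    conv_lhs => rw [← List.ofFn_get (cycleList L.rot⁻¹ v), List.map_ofFn]
    rfl
  simp only [hp, hv]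
  set wp := ∏ p : L.Plaquette, (tr A ∘ₗ LinearMap.mulLeft ℂ zS) (List.ofFn fun k =>
        crossing ((cycleList L.face p).get k).2 (b (a ((cycleList L.face p).get k)))).prod
  set wv := ∏ v : L.Vertex, (cotr A ∘ₗ LinearMap.mulLeft ℂ zTs) (List.ofFn fun k =>
        dualVec b (c ((cycleList L.rot⁻¹ v).get k))).prod
  -- For fixed dart labels the sum over `u` factorizes over the links, each contributing `n` times a
  -- matrix entry of its four legs.
  have hl : ∑ u : E → ι, ∏ e : E,
      (blueWeight 1 [b (inp e), b (c (e, false)), crossing false (b (u e)),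
            crossing false (b (c (e, true)))] *
        redWeight 1 [dualVec b (u e), dualVec b (a (e, false)), dualVec b (out e),
          dualVec b (a (e, true))]) =
      (Module.finrank ℂ A : ℂ) ^ Fintype.card E * siteTensor
        ((fun e => LinearMap.toMatrix b b (coproductSite true (b.coord (a (e, true)))) *
          LinearMap.toMatrix b b (coproductSite false (b.coord (a (e, false))))) *
          fun e => (LinearMap.toMatrix b b (starSite true (b (c (e, true)))) *
            LinearMap.toMatrix b b (starSite false (b (c (e, false)))))) out inp := by
    have h1 := Finset.prod_univ_sum (fun _ : E => (Finset.univ : Finset ι)) (fun e u =>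
      blueWeight 1 [b (inp e), b (c (e, false)), crossing false (b u),
            crossing false (b (c (e, true)))] *
        redWeight 1 [dualVec b u, dualVec b (a (e, false)), dualVec b (out e),
          dualVec b (a (e, true))])
    rw [Fintype.piFinset_univ] at h1
    rw [← h1]
    simp only [sum_link_eq b hA]
    rw [Finset.prod_mul_distrib, Finset.prod_const, Finset.card_univ]
    rfl
  simp only [smul_eq_mul]
  rw [← mul_assoc (wp), mul_left_comm, ← hl, Finset.mul_sum]
  refine Finset.sum_congr rfl fun u _ => ?_
  rw [Finset.prod_mul_distrib]
  ring

end Factorization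

/-! ### Multiplicativity of star and plaquette operators -/

section Projections

variable {ι : Type*} [Fintype ι] [DecidableEq ι] {E : Type*} [Fintype E] [DecidableEq E]
variable {A : Type*} [Ring A] [HopfAlgebra ℂ A] (b : Module.Basis ι ℂ A)

/-- Since `Δ` is multiplicative and legs on distinct darts commute, the rule for one leg, including
its reversed order, passes to the whole cycle. -/
lemma starConv_mul {ds : List (Dart E)} (hn : ds.Nodup) (x y : A) :
    starConv b ds x * starConv b ds y = starConv b ds (y * x) := by
  induction ds generalizing x y with
  | nil =>
    simp only [starConv, List.map_nil, List.prod_nil, LinearMap.convOne_apply, ← map_mul,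
      Bialgebra.counit_mul, mul_comm]
  | cons d ds ih =>
    have hcons : ∀ {κ : Type _} (z : A) (r : Repr ℂ z κ), starConv b (d :: ds) z =
        ∑ i ∈ r.index, starLegLin b d (r.left i) * starConv b ds (r.right i) := fun z r => by
      rw [starConv, List.map_cons, List.prod_cons, r.convMul_apply]; rfl
    rw [List.nodup_cons] at hn
    rw [hcons x (ℛ ℂ x), hcons y (ℛ ℂ y), hcons (y * x) ((ℛ ℂ y).mul (ℛ ℂ x)),
      Repr.mul_index, Finset.sum_product_right, Finset.sum_mul_sum]
    refine Finset.sum_congr rfl fun i _ => Finset.sum_congr rfl fun j _ => ?_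
    rw [Repr.mul_left, Repr.mul_right, ← starLegLin_mul, ← ih hn.2]
    have hc : Commute (starConv b ds ((ℛ ℂ x).right i)) (starLegLin b d ((ℛ ℂ y).left j)) :=
      (commute_starConv b (fun d' hd' z => starLegLin_commute b
        (fun h => hn.1 (by subst h; exact hd')) _ _) _).symm
    rw [mul_assoc, ← mul_assoc (starConv b ds _), hc.eq]
    simp only [mul_assoc]

lemma starConv_one (ds : List (Dart E)) : starConv b ds (1 : A) = 1 := by
  induction ds with
  | nil => simp [starConv]
  | cons d ds ih =>
    rw [starConv, List.map_cons, List.prod_cons, LinearMap.convMul_apply, Bialgebra.comul_one,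
      Algebra.TensorProduct.one_def]
    change starLegLin b d 1 * starConv b ds 1 = 1
    rw [ih, starLegLin_one, one_mul]

lemma contract_plaquetteElement_mul (f : A →ₗ[ℂ] ℂ) (d : Dart E)
    (Y : A ⊗[ℂ] Matrix (E → ι) (E → ι) ℂ) :
    contract f (plaquetteElement b d * Y) =
      ∑ i, plaquetteLegLin b d (b.coord i) * contract (mulLeftDual f (b i)) Y := by
  rw [plaquetteElement, dualElement, Finset.sum_mul, map_sum]
  simp only [contract_tmul_mul]

lemma mulLeftDual_conv (f g : DualAlg A) (x : A) :
    toConv (mulLeftDual (f * g).ofConv x) = ∑ k, ∑ l, (dualVec b k * dualVec b l) x •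
      (toConv (mulLeftDual f.ofConv (b k)) * toConv (mulLeftDual g.ofConv (b l))) := by
  have h := sum_dual_mul_smul b x ((LinearMap.mul ℂ (DualAlg A)).compl₁₂
    ((WithConv.linearEquiv ℂ (A →ₗ[ℂ] ℂ)).symm.toLinearMap ∘ₗ mulLeftDual f.ofConv)
    ((WithConv.linearEquiv ℂ (A →ₗ[ℂ] ℂ)).symm.toLinearMap ∘ₗ mulLeftDual g.ofConv))
  refine Eq.trans ?_ h.symm
  ext y
  change (f * g) (x * y) = (∑ i ∈ (ℛ ℂ x).index, toConv (mulLeftDual f.ofConv ((ℛ ℂ x).left i)) *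
    toConv (mulLeftDual g.ofConv ((ℛ ℂ x).right i))).ofConv y
  rw [((ℛ ℂ x).mul (ℛ ℂ y)).convMul_apply, Repr.mul_index, Finset.sum_product, ofConv_sum,
    LinearMap.sum_apply]
  refine Finset.sum_congr rfl fun i _ => ?_
  exact ((ℛ ℂ y).convMul_apply (toConv (mulLeftDual f.ofConv ((ℛ ℂ x).left i)))
    (toConv (mulLeftDual g.ofConv ((ℛ ℂ x).right i)))).symm

/-- Dual to `starConv_mul`. The first letter is peeled off by `mulLeftDual_conv`, that is `(f * g)(x
·) = ∑ f(x₁ ·) * g(x₂ ·)`. -/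
lemma contract_conv {ds : List (Dart E)} (hn : ds.Nodup) (f g : DualAlg A) :
    contract f.ofConv (ds.map (plaquetteElement b)).prod *
      contract g.ofConv (ds.map (plaquetteElement b)).prod =
      contract (f * g).ofConv (ds.map (plaquetteElement b)).prod := by
  induction ds generalizing f g with
  | nil =>
    have : (f * g) 1 = f 1 * g 1 := by
      rw [LinearMap.convMul_apply, Bialgebra.comul_one, Algebra.TensorProduct.one_def]
      simp
    simp [Algebra.TensorProduct.one_def, this, smul_smul, mul_comm]
  | cons d ds ih =>
    rw [List.nodup_cons] at hn
    simp only [List.map_cons, List.prod_cons, contract_plaquetteElement_mul]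
    set Y := (ds.map (plaquetteElement b)).prod with hY
    have hc : ∀ f g : A →ₗ[ℂ] ℂ, Commute (contract f Y) (plaquetteLegLin b d g) := fun f g =>
      (commute_contract_prod b (fun d' hd' g => plaquetteLegLin_commute b
        (fun h => hn.1 (by subst h; exact hd')) _ _) _).symm
    have h1 : ∀ k, contract (mulLeftDual (f * g).ofConv (b k)) Y =
        ∑ i, ∑ j, (dualVec b i * dualVec b j) (b k) •
          (contract (mulLeftDual f.ofConv (b i)) Y * contract (mulLeftDual g.ofConv (b j)) Y) := by
      intro k
      have := congr(contractLin Y (WithConv.ofConv $(mulLeftDual_conv b f g (b k))))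
      simp only [ofConv_sum, map_sum, ofConv_smul, map_smul] at this
      refine this.trans (Finset.sum_congr rfl fun i _ => Finset.sum_congr rfl fun j _ => ?_)
      rw [contractLin_apply, ← ih hn.2]
    rw [Finset.sum_mul_sum]
    simp only [h1, Finset.mul_sum]
    refine Eq.trans ?_ Finset.sum_comm
    refine Finset.sum_congr rfl fun i _ => ?_
    refine Eq.trans ?_ Finset.sum_comm
    refine Finset.sum_congr rfl fun j _ => ?_
    have h2 : ∑ k, (dualVec b i * dualVec b j) (b k) • plaquetteLegLin b d (b.coord k) =
        plaquetteLegLin b d (dualVec b i * dualVec b j).ofConv := by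
      have := congr(plaquetteLegLin b d
        $(b.sum_dual_apply_smul_coord (dualVec b i * dualVec b j).ofConv))
      simpa only [map_sum, map_smul] using this
    simp only [mul_smul_comm]
    simp only [← smul_mul_assoc]
    rw [← Finset.sum_mul, h2, ← plaquetteLegLin_mul]
    rw [mul_assoc, ← mul_assoc (contract _ Y), (hc _ _).eq]
    simp only [mul_assoc]
    rfl

lemma contract_counit (ds : List (Dart E)) :
    contract (counit (R := ℂ) (A := A)) (ds.map (plaquetteElement b)).prod = 1 := by
  induction ds with
  | nil => simp [Algebra.TensorProduct.one_def]
  | cons d ds ih =>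
    rw [List.map_cons, List.prod_cons, contract_plaquetteElement_mul]
    have h1 : ∀ x : A, mulLeftDual (counit (R := ℂ)) x = counit (R := ℂ) x • counit (R := ℂ) :=
      fun x => by ext y; simp
    have h2 := congr(plaquetteLegLin b d $(b.sum_dual_apply_smul_coord (counit (R := ℂ))))
    rw [plaquetteLegLin_counit, map_sum] at h2
    rw [← h2]
    refine Finset.sum_congr rfl fun i _ => ?_
    rw [h1, ← contractLin_apply, map_smul, contractLin_apply, ih, map_smul, mul_smul_comm, mul_one]

end Projections

/-! ### Exponentials and spectra for idempotent matrices -/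

section Exponential

variable {m : Type*} [Fintype m] [DecidableEq m]

lemma exp_smul_idempotent {P : Matrix m m ℂ} (hP : P * P = P) (x y : ℂ) :
    NormedSpace.exp (x • (1 - P) + y • P) = Complex.exp x • (1 - P) + Complex.exp y • P := by
  have q1 : (1 - P) * (1 - P) = 1 - P := by simp [mul_sub, sub_mul, hP]
  have q2 : (1 - P) * P = 0 := by simp [sub_mul, hP]
  have q3 : P * (1 - P) = 0 := by simp [mul_sub, hP]
  -- An idempotent is a ring homomorphism from `ℂ × ℂ`, so powers, and hence the exponential series,
  -- are computed coordinatewise.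
  let F : ℂ × ℂ →+* Matrix m m ℂ :=
    { toFun := fun z => z.1 • (1 - P) + z.2 • P
      map_one' := by simp
      map_zero' := by simp
      map_mul' := fun z w => by
        simp only [add_mul, mul_add, smul_mul_smul_comm, q1, q2, q3, hP, smul_zero, add_zero,
          zero_add, Prod.fst_mul, Prod.snd_mul]
      map_add' := fun z w => by
        simp only [Prod.fst_add, Prod.snd_add, _root_.add_smul]
        abel }
  have hsum : ∀ z : ℂ, HasSum (fun n : ℕ => ((n.factorial : ℂ)⁻¹ * z ^ n)) (Complex.exp z) := by
    intro z
    have := NormedSpace.exp_series_hasSum_exp' (𝕂 := ℂ) z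
    rwa [← Complex.exp_eq_exp_ℂ] at this
  rw [NormedSpace.exp_eq_tsum ℂ]
  refine HasSum.tsum_eq ?_
  have h := ((hsum x).smul_const (1 - P)).add ((hsum y).smul_const P)
  have hf : ∀ n : ℕ, ((n.factorial : ℂ)⁻¹ • (x • (1 - P) + y • P) ^ n) =
      ((n.factorial : ℂ)⁻¹ * x ^ n) • (1 - P) + ((n.factorial : ℂ)⁻¹ * y ^ n) • P := fun n => by
    have hp : (x • (1 - P) + y • P) ^ n = x ^ n • (1 - P) + y ^ n • P :=
      (map_pow F (x, y) n).symm
    rw [hp, smul_add, smul_smul, smul_smul]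
  simpa only [hf] using h

/-- The spectrum of a matrix is real. -/
def HasRealSpectrum (X : Matrix m m ℂ) : Prop := ∀ μ ∈ spectrum ℂ X, μ.im = 0

lemma hasRealSpectrum_smul_one (c : ℝ) : HasRealSpectrum ((c : ℂ) • (1 : Matrix m m ℂ)) := by
  intro μ hμ
  by_contra h
  refine hμ ?_
  rw [spectrum.mem_resolventSet_iff, Algebra.algebraMap_eq_smul_one, ← sub_smul,
    ← Algebra.algebraMap_eq_smul_one]
  exact (IsUnit.mk0 _ (sub_ne_zero.2 fun hc => h (by simp [hc]))).map _

/-- For non-real `μ` both `μ - X` and `μ - c - X` are invertible. They are what `μ - (X + c P)` is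
on the ranges of `1 - P` and `P`, so it is inverted blockwise. -/
lemma HasRealSpectrum.add_smul {X P : Matrix m m ℂ} (hX : HasRealSpectrum X) (hc : Commute X P)
    (hP : P * P = P) (c : ℝ) : HasRealSpectrum (X + (c : ℂ) • P) := by
  intro μ hμ
  by_contra h
  refine hμ ?_
  rw [spectrum.mem_resolventSet_iff]
  have h1 : IsUnit (algebraMap ℂ (Matrix m m ℂ) μ - X) := by
    by_contra h1
    exact h (hX μ h1)
  have h2 : IsUnit (algebraMap ℂ (Matrix m m ℂ) (μ - c) - X) := by
    by_contra h2
    exact h (by simpa using hX _ h2)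
  obtain ⟨u, hu⟩ := h1
  obtain ⟨v, hv⟩ := h2
  have hcu : Commute (u : Matrix m m ℂ) P := by
    rw [hu]; exact (Algebra.commute_algebraMap_left _ _).sub_left hc
  have hcv : Commute (v : Matrix m m ℂ) P := by
    rw [hv]; exact (Algebra.commute_algebraMap_left _ _).sub_left hc
  have e1 : (algebraMap ℂ (Matrix m m ℂ) μ - (X + (c : ℂ) • P)) = u * (1 - P) + v * P := by
    rw [hu, hv, map_sub, Algebra.algebraMap_eq_smul_one (c : ℂ)]
    simp only [mul_sub, sub_mul, mul_one, smul_mul_assoc, one_mul]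
    abel
  rw [e1]
  refine IsUnit.of_mul_eq_one
    ((1 - P) * (↑u⁻¹ : Matrix m m ℂ) + P * (↑v⁻¹ : Matrix m m ℂ)) ?_
  have q1 : (1 - P) * (1 - P) = 1 - P := by simp [mul_sub, sub_mul, hP]
  have q2 : (1 - P) * P = 0 := by simp [sub_mul, hP]
  have q3 : P * (1 - P) = 0 := by simp [mul_sub, hP]
  calc (↑u * (1 - P) + ↑v * P) * ((1 - P) * (↑u⁻¹ : Matrix m m ℂ) + P * (↑v⁻¹ : Matrix m m ℂ))
      = ↑u * ((1 - P) * (1 - P)) * (↑u⁻¹ : Matrix m m ℂ) +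
          ↑u * ((1 - P) * P) * (↑v⁻¹ : Matrix m m ℂ) +
        (↑v * (P * (1 - P)) * (↑u⁻¹ : Matrix m m ℂ) +
          ↑v * (P * P) * (↑v⁻¹ : Matrix m m ℂ)) := by
        simp only [add_mul, mul_add, mul_assoc]
        abel
    _ = 1 := by
        rw [q1, q2, q3, hP, ((Commute.one_right _).sub_right hcu).eq, hcv.eq]
        simp [mul_assoc]

lemma HasRealSpectrum.add_sum {K : Type*} (s : Finset K) {P : K → Matrix m m ℂ}
    (hP : ∀ k, P k * P k = P k) (hc : ∀ k l, Commute (P k) (P l)) (c : ℝ) {X : Matrix m m ℂ}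
    (hX : HasRealSpectrum X) (hXP : ∀ k, Commute X (P k)) :
    HasRealSpectrum (X + (c : ℂ) • ∑ k ∈ s, P k) := by
  classical
  induction s using Finset.induction_on with
  | empty => simpa using hX
  | insert k s hk ih =>
    rw [Finset.sum_insert hk, smul_add, add_comm (_ • P k), ← add_assoc]
    exact ih.add_smul ((hXP k).add_left
      ((Commute.sum_left _ _ _ fun l _ => hc l k).smul_left _)) (hP k) c

end Exponential

/-! ### Exponentials of sums over commuting idempotents -/

section Logarithm

variable {m : Type*} [Fintype m] [DecidableEq m] {K : Type*}

lemma exp_sum_idempotents (s : Finset K) {P : K → Matrix m m ℂ} (hP : ∀ k, P k * P k = P k)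
    (hc : ∀ k l, Commute (P k) (P l)) (x y : ℂ) {Y : K → Matrix m m ℂ}
    (hY : ∀ k, Complex.exp x • (1 - P k) + Complex.exp y • P k = Y k)
    (h : (s : Set K).Pairwise fun k l => Commute (Y k) (Y l)) :
    NormedSpace.exp (∑ k ∈ s, (x • (1 - P k) + y • P k)) = s.noncommProd Y h := by
  have hl : ∀ k l, Commute (1 - P k) (P l) := fun k l => (Commute.one_left _).sub_left (hc k l)
  have hr : ∀ k l, Commute (P k) (1 - P l) := fun k l => (Commute.one_right _).sub_right (hc k l)
  have hb : ∀ k l, Commute (1 - P k) (1 - P l) := fun k l =>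
    (Commute.one_left _).sub_left (hr k l)
  rw [Matrix.exp_sum_of_commute s _ fun k _ l _ _ =>
    (((hb k l).smul_left x).smul_right x |>.add_right (((hl k l).smul_left x).smul_right y)).add_left
      ((((hr k l).smul_left y).smul_right x).add_right (((hc k l).smul_left y).smul_right y))]
  exact Finset.noncommProd_congr rfl (fun k _ => (exp_smul_idempotent (hP k) x y).trans (hY k)) _

lemma exp_smul_one (c : ℂ) :
    NormedSpace.exp (c • (1 : Matrix m m ℂ)) = Complex.exp c • (1 : Matrix m m ℂ) := by
  simpa using exp_smul_idempotent (P := (1 : Matrix m m ℂ)) (one_mul 1) 0 c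

end Logarithm

/-! ### Centrality of the mixtures and cyclicity of the weights -/

section Mixtures

variable {A : Type*} [Ring A] [HopfAlgebra ℂ A] [Module.Finite ℂ A]

lemma mixUnit_mem_center (hA : IsInvolutory A) (δ : ℝ) :
    mixUnit δ (cotrElement A) ∈ Set.center A := by
  refine Set.smul_mem_center _ (Set.add_mem_center (Set.smul_mem_center _ Set.one_mem_center)
    (Set.smul_mem_center _ ?_))
  exact Semigroup.mem_center_iff.2 fun x => by rw [mul_cotrElement hA, cotrElement_mul hA]

lemma mixCounit_mem_center (hA : IsInvolutory A) (δ : ℝ) :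
    mixCounit δ (toConv (tr A)) ∈ Set.center (DualAlg A) := by
  refine Set.smul_mem_center _ (Set.add_mem_center (Set.smul_mem_center _ Set.one_mem_center)
    (Set.smul_mem_center _ ?_))
  exact Semigroup.mem_center_iff.2 fun f => by rw [conv_mul_tr hA, tr_conv_mul hA]

end Mixtures

section Traces

variable {A : Type*} [Ring A] [HopfAlgebra ℂ A]

lemma tr_comp_mulLeft_comm {z : A} (hz : z ∈ Set.center A) (x y : A) :
    (tr A ∘ₗ LinearMap.mulLeft ℂ z) (x * y) = (tr A ∘ₗ LinearMap.mulLeft ℂ z) (y * x) := by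
  simp only [LinearMap.comp_apply, LinearMap.mulLeft_apply]
  rw [← mul_assoc, tr_mul_comm, ← mul_assoc, ← mul_assoc, Semigroup.mem_center_iff.1 hz]

lemma cotr_comp_mulLeft_comm {z : DualAlg A} (hz : z ∈ Set.center (DualAlg A)) (f g : DualAlg A) :
    (cotr A ∘ₗ LinearMap.mulLeft ℂ z) (f * g) = (cotr A ∘ₗ LinearMap.mulLeft ℂ z) (g * f) := by
  simp only [LinearMap.comp_apply, LinearMap.mulLeft_apply]
  rw [← mul_assoc, cotr_mul_comm, ← mul_assoc, ← mul_assoc, Semigroup.mem_center_iff.1 hz]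

end Traces

/-! ### The idempotents of the model and the Hamiltonian in terms of them -/

section Model

variable {ι : Type*} [Fintype ι] [DecidableEq ι] {E : Type*} [Fintype E] [DecidableEq E]
variable {A : Type*} [Ring A] [HopfAlgebra ℂ A] (b : Module.Basis ι ℂ A) (L : SurfaceLattice E)

/-- The normalized plaquette operator `n⁻¹ B_p⁰`. -/
def plaquetteProj (p : L.Plaquette) : Matrix (E → ι) (E → ι) ℂ :=
  (Module.finrank ℂ A : ℂ)⁻¹ • plaquetteOp L b (1 : A) p

/-- The normalized star operator `n⁻¹ A_s⁰`. -/
def starProj (v : L.Vertex) : Matrix (E → ι) (E → ι) ℂ :=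
  (Module.finrank ℂ A : ℂ)⁻¹ • starOp L b (1 : DualAlg A) v

lemma plaquetteOp_commute (z : A) (p q : L.Plaquette) :
    Commute (plaquetteOp L b z p) (plaquetteOp L b z q) := by
  obtain rfl | h := eq_or_ne p q
  · exact Commute.refl _
  · exact plaquetteOpOf_commute b L _ _ h

lemma starOp_commute (z : DualAlg A) (v w : L.Vertex) :
    Commute (starOp L b z v) (starOp L b z w) := by
  obtain rfl | h := eq_or_ne v w
  · exact Commute.refl _
  · exact starOpOf_commute b L _ _ h

lemma plaquetteOp_starOp_commute (hA : IsInvolutory A) {z : A} (hz : z ∈ Set.center A)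
    {w : DualAlg A} (hw : w ∈ Set.center (DualAlg A)) (p : L.Plaquette) (v : L.Vertex) :
    Commute (plaquetteOp L b z p) (starOp L b w v) :=
  plaquetteOpOf_starOpOf_commute b hA L (tr_comp_mulLeft_comm hz) (cotr_comp_mulLeft_comm hw) p v

lemma plaquetteProj_commute (p q : L.Plaquette) :
    Commute (plaquetteProj b L p) (plaquetteProj b L q) :=
  ((plaquetteOp_commute b L 1 p q).smul_left _).smul_right _

lemma starProj_commute (v w : L.Vertex) : Commute (starProj b L v) (starProj b L w) :=
  ((starOp_commute b L 1 v w).smul_left _).smul_right _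

lemma plaquetteProj_starProj_commute (hA : IsInvolutory A) (p : L.Plaquette) (v : L.Vertex) :
    Commute (plaquetteProj b L p) (starProj b L v) :=
  ((plaquetteOp_starOp_commute b L hA Set.one_mem_center Set.one_mem_center p v).smul_left
    _).smul_right _

variable [Module.Finite ℂ A]

/-- The integral property at `f = tr` reads `tr * tr = n tr`, which `contract_conv` carries over to
operators. -/
lemma plaquetteProj_mul_self (hA : IsInvolutory A) (p : L.Plaquette) :
    plaquetteProj b L p * plaquetteProj b L p = plaquetteProj b L p := by
  have h := contract_conv b (orbitList_nodup L.face (Quotient.out p))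
    (toConv (tr A)) (toConv (tr A))
  rw [tr_conv_mul hA, show (toConv (tr A)) 1 = _ from tr_one, ofConv_smul, ← contractLin_apply,
    ← contractLin_apply, map_smul] at h
  have e : plaquetteOp L b (1 : A) p = contractLin
      ((orbitList L.face (Quotient.out p)).map (plaquetteElement b)).prod
        (toConv (tr A)).ofConv := by
    rw [plaquetteOp, plaquetteOpOf_eq, LinearMap.mulLeft_one, LinearMap.comp_id]; rfl
  rw [plaquetteProj, e, smul_mul_smul_comm, h, smul_smul, mul_assoc,
    inv_mul_cancel₀ finrank_ne_zero, mul_one]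

lemma predual_eq {w : DualAlg A →ₗ[ℂ] ℂ} {x : A} (h : ∀ f, w f = f x) : predual b w = x :=
  ext_dual fun f => (apply_predual b w (toConv f)).trans (h (toConv f))

lemma starOp_one_eq (v : L.Vertex) : starOp L b (1 : DualAlg A) v =
    starConv b (cycleList L.rot⁻¹ v) (cotrElement A) := by
  rw [starOp, starOpOf_eq, predual_eq b (x := cotrElement A)]
  intro f
  rw [LinearMap.mulLeft_one, LinearMap.comp_id, cotr_eq]

lemma starProj_mul_self (hA : IsInvolutory A) (v : L.Vertex) :
    starProj b L v * starProj b L v = starProj b L v := by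
  rw [starProj, starOp_one_eq, smul_mul_smul_comm,
    starConv_mul b (ds := cycleList L.rot⁻¹ v) (orbitList_nodup _ _), mul_cotrElement hA,
    counit_cotrElement]
  change _ • (starConv b _).ofConv _ = _
  rw [map_smul, smul_smul, mul_assoc, inv_mul_cancel₀ finrank_ne_zero, mul_one]

/-- As `tr(ℓ x) = n ε(x)` and the weight `ε` gives the identity operator, the mixture is `2 (1 - δ)
P + δ 1`, with eigenvalue candidates `δ` and `2 - δ`. -/
lemma plaquetteOp_mixUnit (hA : IsInvolutory A) (δ : ℝ) (p : L.Plaquette) :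
    plaquetteOp L b (mixUnit δ (cotrElement A)) p =
      (δ : ℂ) • (1 - plaquetteProj b L p) + (2 - δ : ℂ) • plaquetteProj b L p := by
  have e : ∀ z : A, plaquetteOp L b z p = contractLin
      ((cycleList L.face p).map (plaquetteElement b)).prod (tr A ∘ₗ LinearMap.mulLeft ℂ z) :=
    fun z => by rw [plaquetteOp, plaquetteOpOf_eq]; rfl
  have h : tr A ∘ₗ LinearMap.mulLeft ℂ (mixUnit δ (cotrElement A)) =
      ((Module.finrank ℂ A : ℂ)⁻¹ * (2 * (1 - δ))) • (tr A ∘ₗ LinearMap.mulLeft ℂ 1) +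
        (δ : ℂ) • counit := by
    ext x
    simp only [mixUnit, LinearMap.comp_apply, LinearMap.mulLeft_apply, smul_mul_assoc, add_mul,
      map_smul, map_add, cotrElement_mul hA, tr_cotrElement hA, LinearMap.add_apply,
      LinearMap.smul_apply, smul_eq_mul]
    field_simp [finrank_ne_zero (A := A)]
  have h1 : contractLin ((cycleList L.face p).map (plaquetteElement b)).prod
      (counit (R := ℂ) (A := A)) = 1 := contract_counit b _
  rw [plaquetteProj, e, e, h, map_add, map_smul, map_smul, h1]
  module

/-- Dually, `cotr(tr * f) = n f(1)`, so the part `Λ = tr` of the mixture is represented by the unit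
of `A`, which acts as the identity. -/
lemma starOp_mixCounit (hA : IsInvolutory A) (δ : ℝ) (v : L.Vertex) :
    starOp L b (mixCounit δ (toConv (tr A))) v =
      (δ : ℂ) • (1 - starProj b L v) + (2 - δ : ℂ) • starProj b L v := by
  have h : predual b (cotr A ∘ₗ LinearMap.mulLeft ℂ (mixCounit δ (toConv (tr A)))) =
      ((Module.finrank ℂ A : ℂ)⁻¹ * (2 * (1 - δ))) • cotrElement A + (δ : ℂ) • 1 := by
    refine predual_eq b fun f => ?_
    have h1 : cotr A (toConv (tr A)) = Module.finrank ℂ A := by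
      rw [cotr_eq]; exact tr_cotrElement hA
    have h2 : ∀ x y : A, ∀ c d : ℂ, f (c • x + d • y) = c * f x + d * f y := fun x y c d => by
      change f.ofConv _ = _
      rw [map_add, map_smul, map_smul]; rfl
    rw [h2]
    simp only [mixCounit, LinearMap.comp_apply, LinearMap.mulLeft_apply, smul_mul_assoc, add_mul,
      map_smul, map_add, tr_conv_mul hA, h1, one_mul, smul_eq_mul, cotr_eq f]
    field_simp [finrank_ne_zero (A := A)]
  rw [starProj, starOp_one_eq, starOp, starOpOf_eq, h]
  have h1 : (starConv b (cycleList L.rot⁻¹ v)).ofConv (1 : A) = 1 := starConv_one b _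
  change (starConv b _).ofConv _ = _ • (1 - _ • (starConv b _).ofConv _) +
    _ • _ • (starConv b _).ofConv _
  rw [map_add, map_smul, map_smul, h1]
  module

lemma plaquetteOpOf_haar (hA : IsInvolutory A) {φ : DualAlg A} (hφ : IsIntegralFunctional φ)
    (h1 : φ 1 = 1) (p : L.Plaquette) : plaquetteOpOf L b φ.ofConv p = plaquetteProj b L p := by
  rw [hφ.eq_smul hA, h1, plaquetteProj, plaquetteOp, plaquetteOpOf_eq, plaquetteOpOf_eq,
    LinearMap.mulLeft_one, LinearMap.comp_id, ofConv_smul, ← contractLin_apply, map_smul,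
    one_div]
  rfl

lemma starOpOf_haar (hA : IsInvolutory A) {h : A} (hh : IsCointegral h)
    (h1 : counit (R := ℂ) h = 1) (v : L.Vertex) :
    starOpOf L b (LinearMap.applyₗ h ∘ₗ (WithConv.linearEquiv ℂ (A →ₗ[ℂ] ℂ)).toLinearMap) v =
      starProj b L v := by
  rw [starOpOf_eq, predual_eq b (x := h) fun f => rfl, starProj, starOp_one_eq, hh.eq_smul hA, h1,
    one_div]
  exact map_smul (starConv b _).ofConv _ _

lemma hamiltonian_eq (γp γs γ : ℝ) : hamiltonian (A := A) L b γp γs γ =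
    (2 * γp : ℂ) • ∑ p, plaquetteProj b L p + (2 * γs : ℂ) • ∑ v, starProj b L v -
      ((γp * Fintype.card L.Plaquette + γs * Fintype.card L.Vertex + γ : ℝ) : ℂ) • 1 := by
  have hp : ∀ p, (2 / (Module.finrank ℂ A : ℂ)) • plaquetteOp L b (1 : A) p =
      (2 : ℂ) • plaquetteProj b L p := fun p => by rw [plaquetteProj, smul_smul, div_eq_mul_inv]
  have hv : ∀ v, (2 / (Module.finrank ℂ A : ℂ)) • starOp L b (1 : DualAlg A) v =
      (2 : ℂ) • starProj b L v := fun v => by rw [starProj, smul_smul, div_eq_mul_inv]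
  simp only [hamiltonian, hp, hv, Finset.sum_sub_distrib, ← Finset.smul_sum, Finset.sum_const,
    Finset.card_univ, ← Nat.cast_smul_eq_nsmul ℂ]
  push_cast
  module

end Model

/-! ### The principal logarithm of the transfer matrix -/

section PrincipalLog

variable {ι : Type*} [Fintype ι] [DecidableEq ι] {E : Type*} [Fintype E] [DecidableEq E]
variable {A : Type*} [Ring A] [HopfAlgebra ℂ A] [Module.Finite ℂ A]
variable (b : Module.Basis ι ℂ A) (L : SurfaceLattice E)

/-- With coefficients `ln δ` and `ln (2 - δ)` on `1 - P` and `P`, half the difference is the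
coupling of `1 - 2 P` and half the sum is the contribution to `γ`. -/
lemma neg_hamiltonian_eq_sum {δp δs γp γs γ : ℝ} (hp : 0 < δp) (hp1 : δp ≤ 1) (hs : 0 < δs)
    (hs1 : δs ≤ 1) (hγp : γp = 1 / 2 * Real.log (δp / (2 - δp)))
    (hγs : γs = 1 / 2 * Real.log (δs / (2 - δs)))
    (hγ : γ = Fintype.card E * Real.log (Module.finrank ℂ A) +
      Fintype.card L.Plaquette / 2 * Real.log (δp * (2 - δp)) +
      Fintype.card L.Vertex / 2 * Real.log (δs * (2 - δs))) :
    -hamiltonian (A := A) L b γp γs γ =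
      ((Fintype.card E * Real.log (Module.finrank ℂ A) : ℝ) : ℂ) • 1 +
        (∑ p, ((Real.log δp : ℂ) • (1 - plaquetteProj b L p) +
          (Real.log (2 - δp) : ℂ) • plaquetteProj b L p) +
        ∑ v, ((Real.log δs : ℂ) • (1 - starProj b L v) +
          (Real.log (2 - δs) : ℂ) • starProj b L v)) := by
  rw [Real.log_div hp.ne' (by linarith)] at hγp
  rw [Real.log_div hs.ne' (by linarith)] at hγs
  rw [Real.log_mul hp.ne' (by linarith), Real.log_mul hs.ne' (by linarith)] at hγ
  rw [hamiltonian_eq, hγ, hγp, hγs]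
  simp only [Finset.sum_add_distrib, ← Finset.smul_sum, Finset.sum_sub_distrib, Finset.sum_const,
    Finset.card_univ, ← Nat.cast_smul_eq_nsmul ℂ]
  push_cast
  module

/-- `-H` is a real combination of commuting idempotents; no inner product is involved. -/
lemma hasRealSpectrum_neg_hamiltonian (hA : IsInvolutory A) (γp γs γ : ℝ) :
    HasRealSpectrum (-hamiltonian (A := A) L b γp γs γ) := by
  have h1 := (hasRealSpectrum_smul_one (m := E → ι)
    (γp * Fintype.card L.Plaquette + γs * Fintype.card L.Vertex + γ)).add_sum Finset.univ
    (plaquetteProj_mul_self b L hA) (plaquetteProj_commute b L) (-(2 * γp))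
    fun p => (Commute.one_left _).smul_left _
  have h2 := h1.add_sum Finset.univ (starProj_mul_self b L hA) (starProj_commute b L) (-(2 * γs))
    fun v => ((Commute.one_left _).smul_left _).add_left
      ((Commute.sum_left _ _ _ fun p _ => plaquetteProj_starProj_commute b L hA p v).smul_left _)
  convert h2 using 1
  rw [hamiltonian_eq]
  push_cast
  module

lemma isPrincipalLog_neg_hamiltonian (hA : IsInvolutory A) {δp δs γp γs γ : ℝ} (hp : 0 < δp)
    (hp1 : δp ≤ 1) (hs : 0 < δs) (hs1 : δs ≤ 1)
    (hγp : γp = 1 / 2 * Real.log (δp / (2 - δp))) (hγs : γs = 1 / 2 * Real.log (δs / (2 - δs)))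
    (hγ : γ = Fintype.card E * Real.log (Module.finrank ℂ A) +
      Fintype.card L.Plaquette / 2 * Real.log (δp * (2 - δp)) +
      Fintype.card L.Vertex / 2 * Real.log (δs * (2 - δs))) :
    IsPrincipalLog (transferMatrix L b 1 (mixUnit δp (cotrElement A))
      (mixCounit δs (toConv (tr A))) 1) (-hamiltonian L b γp γs γ) := by
  refine ⟨?_, fun μ hμ => ?_⟩
  · have hexp : ∀ x : ℝ, 0 < x → Complex.exp (Real.log x) = x := fun x hx => by
      rw [← Complex.ofReal_exp, Real.exp_log hx]
    have hn : (0 : ℝ) < Module.finrank ℂ A := by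
      have := finrank_ne_zero (A := A)
      exact_mod_cast Nat.pos_of_ne_zero fun h => this (by rw [h, Nat.cast_zero])
    have hsplit : ∀ (P : Matrix (E → ι) (E → ι) ℂ) {Q : Matrix (E → ι) (E → ι) ℂ} (x y : ℂ),
        Commute P Q → Commute P (x • (1 - Q) + y • Q) := fun P Q x y h =>
      (((Commute.one_right P).sub_right h).smul_right x).add_right (h.smul_right y)
    rw [neg_hamiltonian_eq_sum b L hp hp1 hs hs1 hγp hγs hγ,
      transferMatrix_eq b hA L _ _ (fun p _ q _ _ => plaquetteOp_commute b L _ p q)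
        (fun v _ w _ _ => starOp_commute b L _ v w),
      Matrix.exp_add_of_commute _ _ ((Commute.one_left _).smul_left _),
      Matrix.exp_add_of_commute _ _ (Commute.sum_left _ _ _ fun p _ =>
        Commute.sum_right _ _ _ fun v _ => hsplit _ _ _ (hsplit _ _ _
          (plaquetteProj_starProj_commute b L hA p v).symm).symm),
      exp_smul_one, exp_sum_idempotents Finset.univ (plaquetteProj_mul_self b L hA)
        (plaquetteProj_commute b L) _ _ (fun p => ?_)
        (fun p _ q _ _ => plaquetteOp_commute b L _ p q),
      exp_sum_idempotents Finset.univ (starProj_mul_self b L hA)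
        (starProj_commute b L) _ _ (fun v => ?_)
        (fun v _ w _ _ => starOp_commute b L _ v w), smul_mul_assoc, one_mul]
    · congr 1
      rw [← Complex.ofReal_exp, mul_comm, Real.exp_mul, Real.exp_log hn, Real.rpow_natCast]
      push_cast
      rfl
    · rw [starOp_mixCounit b L hA, hexp _ hs, hexp _ (by linarith)]
      push_cast
      rfl
    · rw [plaquetteOp_mixUnit b L hA, hexp _ hp, hexp _ (by linarith)]
      push_cast
      rfl
  · rw [hasRealSpectrum_neg_hamiltonian b L hA γp γs γ μ hμ]
    exact ⟨by simpa using Real.pi_pos, Real.pi_pos⟩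

lemma log_div_two_sub_nonpos {δ : ℝ} (h : 0 < δ) (h1 : δ ≤ 1) :
    1 / 2 * Real.log (δ / (2 - δ)) ≤ 0 :=
  mul_nonpos_of_nonneg_of_nonpos (by norm_num) (Real.log_nonpos
    (div_nonneg h.le (by linarith)) ((div_le_one (by linarith)).2 (by linarith)))

end PrincipalLog

end HopfLattice

end

/-! ### The main theorem -/

theorem mainTheorem2
    {A : Type*} [Ring A] [HopfAlgebra ℂ A] (hA : IsInvolutory A)
    {ι : Type*} [Fintype ι] [DecidableEq ι] (b : Module.Basis ι ℂ A)
    {E : Type*} [Fintype E] [DecidableEq E] (L : SurfaceLattice E)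
    (lam : A) (hlam : IsCointegral lam) (hlam_tr : tr A lam = Module.finrank ℂ A)
    (Lam : DualAlg A) (hLam : IsIntegralFunctional Lam)
    (hLam_cotr : cotr A Lam = Module.finrank ℂ A) :
    -- the factorization of the transfer matrix, for all central `zS` and co-central `zTs`
    (∀ zS ∈ Set.center A, ∀ zTs ∈ Set.center (DualAlg A),
      (∀ p v, Commute (plaquetteOp L b zS p) (starOp L b zTs v)) ∧
      ∃ (hB : (↑(Finset.univ : Finset L.Plaquette) : Set L.Plaquette).Pairwise
            fun p q => Commute (plaquetteOp L b zS p) (plaquetteOp L b zS q))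
        (hS : (↑(Finset.univ : Finset L.Vertex) : Set L.Vertex).Pairwise
            fun v w => Commute (starOp L b zTs v) (starOp L b zTs w)),
        transferMatrix L b 1 zS zTs 1 =
          ((Module.finrank ℂ A : ℂ) ^ Fintype.card E) •
            (Finset.univ.noncommProd (plaquetteOp L b zS) hB *
              Finset.univ.noncommProd (starOp L b zTs) hS)) ∧
    -- the mixtures are admissible parameters
    (∀ δp δs : ℝ, mixUnit δp lam ∈ Set.center A ∧ mixCounit δs Lam ∈ Set.center (DualAlg A)) ∧
    -- the logarithm of the transfer matrix
    (∀ δp δs γp γs γ : ℝ, 0 < δp → δp ≤ 1 → 0 < δs → δs ≤ 1 →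
      γp = 1 / 2 * Real.log (δp / (2 - δp)) →
      γs = 1 / 2 * Real.log (δs / (2 - δs)) →
      γ = Fintype.card E * Real.log (Module.finrank ℂ A) +
          Fintype.card L.Plaquette / 2 * Real.log (δp * (2 - δp)) +
          Fintype.card L.Vertex / 2 * Real.log (δs * (2 - δs)) →
      IsPrincipalLog (transferMatrix L b 1 (mixUnit δp lam) (mixCounit δs Lam) 1)
        (-hamiltonian L b γp γs γ) ∧
      -- this is the quantum double Hamiltonian, with couplings `-2 γs, -2 γp ≥ 0`, up to a constant
      γp ≤ 0 ∧ γs ≤ 0 ∧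
      ∀ (h : A) (φ : DualAlg A), IsCointegral h → Coalgebra.counit (R := ℂ) h = 1 →
        IsIntegralFunctional φ → φ 1 = 1 →
        hamiltonian L b γp γs γ =
          quantumDoubleHamiltonian L b h φ (-2 * γs) (-2 * γp) -
            ((γp * Fintype.card L.Plaquette + γs * Fintype.card L.Vertex + γ : ℝ) : ℂ) • 1) := by
  have : Module.Finite ℂ A := Module.Finite.of_basis b
  -- The normalizations leave no freedom: `lam` and `Lam` are replaced by the canonical `ℓ` and
  -- `tr`.
  obtain rfl := hlam.eq_cotrElement hA hlam_tr
  obtain rfl := hLam.eq_tr hA hLam_cotr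
  refine ⟨fun zS hzS zTs hzTs => ⟨plaquetteOp_starOp_commute b L hA hzS hzTs,
      fun p _ q _ _ => plaquetteOp_commute b L zS p q,
      fun v _ w _ _ => starOp_commute b L zTs v w, transferMatrix_eq b hA L zS zTs _ _⟩,
    fun δp δs => ⟨mixUnit_mem_center hA δp, mixCounit_mem_center hA δs⟩,
    fun δp δs γp γs γ hp hp1 hs hs1 hγp hγs hγ =>
      ⟨isPrincipalLog_neg_hamiltonian b L hA hp hp1 hs hs1 hγp hγs hγ,
        hγp ▸ log_div_two_sub_nonpos hp hp1, hγs ▸ log_div_two_sub_nonpos hs hs1,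
        fun h φ hh hh1 hφ hφ1 => ?_⟩⟩
  -- The Haar integrals are `ℓ/n` and `tr/n`, so their operators are the idempotents in terms of
  -- which `H` is already written.
  simp only [hamiltonian_eq, quantumDoubleHamiltonian, plaquetteOpOf_haar b L hA hφ hφ1,
    starOpOf_haar b L hA hh hh1]
  push_cast
  module
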